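/- Let $\nu$ be the law of a random variable $W$ with $\mathbb P(W>0)=1$ and $x_0:=\sup\{x>0:\mathbb P(W\le x)<1\}=1$, and let $\theta:=1+\mathbb E[W]$. Consider the weighted recursive tree (WRT) with weight distribution $\nu$: the weights $W_1,W_2,\ldots$ are i.i.d. copies of $W$; the tree starts from the single vertex $1$; and, conditionally on the weights $(W_i)_{i\ge1}$, for each $n\ge1$ the new vertex $n+1$ sends, independently of all other vertices, one directed edge to a vertex in $\{1,\ldots,n\}$, namely to vertex $i$ with probability $W_i/\sum_{j=1}^nW_j$. Let $\mathcal Z_n(i)$ be the in-degree of vertex $i$ in the tree on the vertices $1,\ldots,n$. Fix $c\in(0,\theta/(\theta-1))$ and let $(d_n)_{n\ge1}$ be a sequence of non-negative integers with $d_n\to\infty$ and $d_n<c\log n$ for all sufficiently large $n$. Then $$\lim_{n\to\infty}n\,\mathbb E\Big[\Big(\frac{W}{\theta-1+W}\Big)^{d_n}\Big]=0\quad\Longrightarrow\quad\lim_{n\to\infty}\mathbb P\Big(\max_{1\le i\le n}\mathcal Z_n(i)\ge d_n\Big)=0,$$ and $$\lim_{n\to\infty}n\,\mathbb E\Big[\Big(\frac{W}{\theta-1+W}\Big)^{d_n}\Big]=\infty\quad\Longrightarrow\quad\lim_{n\to\infty}\mathbb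 P\Big(\max_{1\le i\le n}\mathcal Z_n(i)\ge d_n\Big)=1.$$ -/

import Mathlib

open MeasureTheory ProbabilityTheory Filter Topology

noncomputable section

namespace WRT

/-- The law of the neighbour to which the new vertex `j` attaches, given the weights `w`:
vertex `i ∈ {0, …, j - 1}` is chosen with probability `w i / (w 0 + ⋯ + w (j - 1))`.
Vertices are labelled `0, 1, 2, …`, where `0` is the root.
The root `0` does not attach to anything (its value `0` is a placeholder that is never counted as an
edge), and for weights that are not all positive, which is an event of probability zero below,
the value is also the placeholder `dirac 0`. -/
def parentLaw (w : ℕ → ℝ) (j : ℕ) : Measure ℕ :=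
  open Classical in
  if 0 < j ∧ ∀ i < j, 0 < w i then
    ∑ i ∈ Finset.range j,
      ENNReal.ofReal (w i / ∑ l ∈ Finset.range j, w l) • Measure.dirac i
  else Measure.dirac 0

instance isProbabilityMeasure_parentLaw (w : ℕ → ℝ) (j : ℕ) :
    IsProbabilityMeasure (parentLaw w j) := by
  classical
  unfold parentLaw
  split_ifs with h
  · obtain ⟨hj, hw⟩ := h
    have hpos : 0 < ∑ l ∈ Finset.range j, w l :=
      Finset.sum_pos (fun i hi => hw i (Finset.mem_range.1 hi)) ⟨0, Finset.mem_range.2 hj⟩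
    constructor
    simp only [Measure.finsetSum_apply, Measure.smul_apply, measure_univ, smul_eq_mul, mul_one]
    rw [← ENNReal.ofReal_sum_of_nonneg, ← Finset.sum_div, div_self hpos.ne', ENNReal.ofReal_one]
    intro i hi
    exact div_nonneg (hw i (Finset.mem_range.1 hi)).le hpos.le
  · infer_instance

theorem measurable_parentLaw (j : ℕ) : Measurable fun w : ℕ → ℝ => parentLaw w j := by
  classical
  unfold parentLaw
  refine Measurable.ite ?_ ?_ measurable_const
  · have : {w : ℕ → ℝ | 0 < j ∧ ∀ i < j, 0 < w i} =
        {w : ℕ → ℝ | 0 < j} ∩ ⋂ i, ⋂ _ : i < j, {w : ℕ → ℝ | 0 < w i} := by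
      ext w; simp
    rw [this]
    refine MeasurableSet.inter (MeasurableSet.const _) ?_
    exact MeasurableSet.iInter fun i => MeasurableSet.iInter fun _ =>
      measurableSet_lt measurable_const (measurable_pi_apply i)
  · refine Measure.measurable_of_measurable_coe _ fun s hs => ?_
    simp only [Measure.finsetSum_apply, Measure.smul_apply, smul_eq_mul]
    fun_prop

/-- Given the weights, all new vertices choose their neighbours independently. -/
def parentKernel : Kernel (ℕ → ℝ) (ℕ → ℕ) where
  toFun w := Measure.infinitePi (parentLaw w)
  measurable' := by
    refine Measurable.measure_of_isPiSystem_of_isProbabilityMeasure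
      (S := squareCylinders fun _ : ℕ => {s : Set ℕ | MeasurableSet s})
      generateFrom_squareCylinders.symm
      (isPiSystem_squareCylinders (fun _ => MeasurableSpace.isPiSystem_measurableSet)
        (by simp)) ?_
    rintro _ ⟨s, t, ht, rfl⟩
    have ht' : ∀ i, MeasurableSet (t i) := fun i => by simp
    have h : ∀ w : ℕ → ℝ, Measure.infinitePi (parentLaw w) ((s : Set ℕ).pi t) =
        ∏ i ∈ s, parentLaw w i (t i) := fun w => Measure.infinitePi_pi _ fun i _ => ht' i
    simp only [h]
    exact Finset.measurable_prod _ fun i _ =>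
      (Measure.measurable_coe (ht' i)).comp (measurable_parentLaw i)

instance isMarkovKernel_parentKernel : IsMarkovKernel parentKernel :=
  ⟨fun w => inferInstanceAs (IsProbabilityMeasure (Measure.infinitePi (parentLaw w)))⟩

/-- The joint law of the weights and of the attachment choices in the weighted recursive tree:
the weights are i.i.d. with law `ν`, and given the weights the choices have law `parentKernel`. -/
def law (ν : Measure ℝ) [IsProbabilityMeasure ν] : Measure ((ℕ → ℝ) × (ℕ → ℕ)) :=
  Measure.infinitePi (fun _ : ℕ => ν) ⊗ₘ parentKernel

instance isProbabilityMeasure_law (ν : Measure ℝ) [IsProbabilityMeasure ν] :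
    IsProbabilityMeasure (law ν) := by
  unfold law; infer_instance

/-- `(W, A)` is a weighted recursive tree with weight distribution `ν` on the probability space
`(Ω, P)`: `W i` is the weight of vertex `i`, and `A j` is the older vertex to which the
edge of vertex `j ≥ 1` points. -/
def IsWRT {Ω : Type*} [MeasurableSpace Ω] (P : Measure Ω) (ν : Measure ℝ) [IsProbabilityMeasure ν]
    (W : ℕ → Ω → ℝ) (A : ℕ → Ω → ℕ) : Prop :=
  HasLaw (fun ω => ((fun i => W i ω), (fun j => A j ω))) (law ν) P

/-- The in-degree of vertex `i` in the tree on the `n` vertices `0, …, n - 1`. -/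
def inDegree (a : ℕ → ℕ) (n i : ℕ) : ℕ :=
  ((Finset.Ico 1 n).filter fun j => a j = i).card

/-- The maximum in-degree in the tree on the `n` vertices `0, …, n - 1`. -/
def maxInDegree (a : ℕ → ℕ) (n : ℕ) : ℕ :=
  (Finset.range n).sup (inDegree a n)

/-- `θ = 1 + 𝔼[W]`. -/
def theta (ν : Measure ℝ) : ℝ := 1 + ∫ x, x ∂ν

/-- `𝔼[(W / (θ - 1 + W)) ^ k]`. -/
def tailProb (ν : Measure ℝ) (k : ℕ) : ℝ :=
  ∫ x, (x / (theta ν - 1 + x)) ^ k ∂ν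

end WRT

end

/-! By the law of large numbers the total weight of the first `j` vertices is about `μ j`, where `μ
= θ - 1`, so a vertex of weight `v` receives the edge of vertex `j` with probability about `r / j`,
where `r = v / μ`. For a fixed `v`, let `D n d` be the sum over the birth times `i < n` of the
probability of degree at least `d`. All these vertices share the same success probability at time
`n`, so `D (n+1) d = (1 - r/n) D n d + (r/n) D n (d-1)` with `D n 0 = n`. The exact solution is `n x
^ d` with `x = r / (1 + r) = v / (μ + v)`. Integrating over `v` gives `n * tailProb ν d` as the
approximate expected number of vertices of degree at least `d`.

If this tends to `0`, a union bound suffices. If it tends to infinity, the in-degrees are negatively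
dependent given the weights (`measureReal_degLT_le_prod`). After averaging over the independent
weights, the probability that no degree reaches `d` is at most `exp (-∫ D)`.

Two errors need control. The relative fluctuation `err j` of the total weight is summable against `1
/ j`, so it costs only a constant factor. The times before a fixed `m` are not controlled at all.
For the upper bound they cost at most `m` degrees, which association absorbs
(`IsWeightLaw.tailProb_mul_le`). For the lower bound they create a correction of order `n ^ s * y ^
d` with `y = x (1 + η)`. For weights near `1` this is negligible against `n x ^ d` because `d < c
log n` with `c < θ / (θ - 1) = 1 + 1/μ`. Finally `n → ∞` for fixed `m`, then `m → ∞`. -/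

namespace WRT

/-! ### Tails of sums of independent trials -/

/-- The probability that at least `d` of `n` independent trials succeed, where trial `j < n`
succeeds with probability `p j`. -/
noncomputable def binTail (p : ℕ → ℝ) : ℕ → ℕ → ℝ
  | 0, d => if d = 0 then 1 else 0
  | n + 1, d => (1 - p n) * binTail p n d + p n * binTail p n (d - 1)

theorem binTail_succ (p : ℕ → ℝ) (n d : ℕ) :
    binTail p (n + 1) d = (1 - p n) * binTail p n d + p n * binTail p n (d - 1) := rfl

@[simp]
theorem binTail_zero_right (p : ℕ → ℝ) (n : ℕ) : binTail p n 0 = 1 := by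
  induction n with
  | zero => simp [binTail]
  | succ n ih => simp [binTail_succ, ih]

theorem binTail_nonneg {p : ℕ → ℝ} (hp : ∀ j, p j ∈ Set.Icc 0 1) (n d : ℕ) :
    0 ≤ binTail p n d := by
  induction n generalizing d with
  | zero => simp only [binTail]; split_ifs <;> norm_num
  | succ n ih =>
    rw [binTail_succ]
    have := (hp n).1
    have := sub_nonneg.2 (hp n).2
    have := ih d
    have := ih (d - 1)
    positivity

theorem binTail_le_one {p : ℕ → ℝ} (hp : ∀ j, p j ∈ Set.Icc 0 1) (n d : ℕ) :
    binTail p n d ≤ 1 := by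
  induction n generalizing d with
  | zero => simp only [binTail]; split_ifs <;> norm_num
  | succ n ih =>
    rw [binTail_succ]
    have h0 := (hp n).1
    have h1 := sub_nonneg.2 (hp n).2
    nlinarith [mul_le_mul_of_nonneg_left (ih d) h1, mul_le_mul_of_nonneg_left (ih (d - 1)) h0]

theorem binTail_le_pred {p : ℕ → ℝ} (hp : ∀ j, p j ∈ Set.Icc 0 1) (n d : ℕ) :
    binTail p n d ≤ binTail p n (d - 1) := by
  induction n generalizing d with
  | zero =>
    rcases d with _ | _ | d
    · simp
    · simp [binTail]
    · simp [binTail]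
  | succ n ih =>
    rw [binTail_succ, binTail_succ]
    have h0 := (hp n).1
    have h1 := sub_nonneg.2 (hp n).2
    exact add_le_add (mul_le_mul_of_nonneg_left (ih d) h1)
      (mul_le_mul_of_nonneg_left (ih (d - 1)) h0)

theorem binTail_eq_zero_of_lt (p : ℕ → ℝ) {n d : ℕ} (h : n < d) : binTail p n d = 0 := by
  induction n generalizing d with
  | zero => simp [binTail, h.ne']
  | succ n ih => rw [binTail_succ, ih (by omega), ih (by omega)]; simp

theorem binTail_eq_zero_of_forall {p : ℕ → ℝ} {n d : ℕ} (h : ∀ j < n, p j = 0) (hd : 0 < d) :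
    binTail p n d = 0 := by
  induction n with
  | zero => simp [binTail, hd.ne']
  | succ n ih =>
    rw [binTail_succ, ih fun j hj => h j (by omega), h n (by omega)]; simp

/-- A larger success probability shifts mass from threshold `d` to `d - 1`, where the tail is larger
by `binTail_le_pred`. -/
theorem binTail_mono {p q : ℕ → ℝ} (hp : ∀ j, p j ∈ Set.Icc 0 1) (hq : ∀ j, q j ∈ Set.Icc 0 1)
    (n d : ℕ) (h : ∀ j < n, p j ≤ q j) : binTail p n d ≤ binTail q n d := by
  induction n generalizing d with
  | zero => rfl
  | succ n ih =>
    rw [binTail_succ, binTail_succ]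
    have h1 := ih d fun j hj => h j (by omega)
    have h2 := ih (d - 1) fun j hj => h j (by omega)
    have h3 := h n (by omega)
    have h4 := binTail_le_pred hp n d
    have h5 := (hq n).1
    have h6 := sub_nonneg.2 (hq n).2
    nlinarith [mul_le_mul_of_nonneg_left h1 h6, mul_le_mul_of_nonneg_left h2 h5,
      mul_nonneg (sub_nonneg.2 h3) (sub_nonneg.2 h4)]

theorem measurable_binTail {α : Type*} [MeasurableSpace α] {p : α → ℕ → ℝ}
    (hp : ∀ j, Measurable fun a => p a j) (n d : ℕ) : Measurable fun a => binTail (p a) n d := by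
  induction n generalizing d with
  | zero => simp only [binTail]; exact measurable_const
  | succ n ih =>
    simp only [binTail_succ]
    exact ((measurable_const.sub (hp n)).mul (ih d)).add ((hp n).mul (ih (d - 1)))

/-- The trials `p`, where those up to time `i` are replaced by failures. -/
def after (i : ℕ) (p : ℕ → ℝ) (j : ℕ) : ℝ := if i < j then p j else 0

theorem after_mem_Icc {p : ℕ → ℝ} (hp : ∀ j, p j ∈ Set.Icc 0 1) (i j : ℕ) :
    after i p j ∈ Set.Icc (0 : ℝ) 1 := by
  unfold after
  split_ifs
  · exact hp j
  · simp

/-! ### The closed recursion for the degree sum over birth times -/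

/-- The expected number of vertices `i < n` with at least `d` successes in the trials
`i + 1, …, n - 1`. -/
noncomputable def degSum (p : ℕ → ℝ) (n d : ℕ) : ℝ :=
  ∑ i ∈ Finset.range n, binTail (after i p) n d

@[simp]
theorem degSum_zero_right (p : ℕ → ℝ) (n : ℕ) : degSum p n 0 = n := by
  simp [degSum]

/-- The trial at time `n` is common to all `i < n`, and the new index `i = n` has had no trial yet,
so it contributes nothing when `d > 0`. Hence the recursion closes. -/
theorem degSum_succ (p : ℕ → ℝ) (n : ℕ) {d : ℕ} (hd : 0 < d) :
    degSum p (n + 1) d = (1 - p n) * degSum p n d + p n * degSum p n (d - 1) := by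
  unfold degSum
  rw [Finset.sum_range_succ, binTail_eq_zero_of_forall _ hd, add_zero, Finset.mul_sum,
    Finset.mul_sum, ← Finset.sum_add_distrib]
  · refine Finset.sum_congr rfl fun i hi => ?_
    rw [binTail_succ]
    simp [after, Finset.mem_range.1 hi]
  · intro j hj
    simp [after, show ¬ n < j by omega]

theorem degSum_nonneg {p : ℕ → ℝ} (hp : ∀ j, p j ∈ Set.Icc 0 1) (n d : ℕ) :
    0 ≤ degSum p n d :=
  Finset.sum_nonneg fun _ _ => binTail_nonneg (after_mem_Icc hp _) _ _

theorem degSum_le {p : ℕ → ℝ} (hp : ∀ j, p j ∈ Set.Icc 0 1) (n d : ℕ) :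
    degSum p n d ≤ n := by
  simpa [degSum] using Finset.sum_le_card_nsmul (Finset.range n) _ 1
    fun i _ => binTail_le_one (after_mem_Icc hp i) n d

theorem degSum_eq_zero_of_lt (p : ℕ → ℝ) {n d : ℕ} (h : n < d) : degSum p n d = 0 :=
  Finset.sum_eq_zero fun _ _ => binTail_eq_zero_of_lt _ h

/-- If the success probabilities are `r / j` up to a factor `1 + ε j`, then `degSum` is bounded by
the exact solution `n * x ^ d`, with `x = r / (1 + r)`, up to a factor independent of `r`. -/
theorem degSum_le_of_le {q ε : ℕ → ℝ} {r x : ℝ} {m : ℕ} (hm : 0 < m)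
    (hq : ∀ j, q j ∈ Set.Icc 0 1) (hε : ∀ j, 0 ≤ ε j) (hx0 : 0 ≤ x) (hrx : r * (1 - x) = x)
    (hqm : ∀ j, m ≤ j → q j = r * (1 + ε j) / j) {n : ℕ} (hn : m ≤ n) (e : ℕ) :
    degSum q n (m + e) ≤ Real.exp (∑ j ∈ Finset.range n, ε j / (j + 1)) * n * x ^ e := by
  have hB : ∀ n, 1 ≤ Real.exp (∑ j ∈ Finset.range n, ε j / (j + 1)) := fun n =>
    Real.one_le_exp (Finset.sum_nonneg fun j _ => div_nonneg (hε j) (by positivity))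
  have h0 : ∀ n, degSum q n (m + 0) ≤
      Real.exp (∑ j ∈ Finset.range n, ε j / (j + 1)) * n * x ^ 0 := fun n => by
    have := degSum_le hq n m
    have h2 : (0 : ℝ) ≤ n := Nat.cast_nonneg n
    simp only [pow_zero, mul_one, add_zero]
    nlinarith [hB n]
  induction n, hn using Nat.le_induction generalizing e with
  | base =>
    -- The first `m` trials are arbitrary, but they cannot yield more than `m` successes. This is
    -- why the threshold starts at `m`.
    rcases e with _ | e
    · exact h0 m
    · rw [degSum_eq_zero_of_lt _ (by omega)]
      positivity
  | succ n hn ih =>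
    rcases e with _ | e
    · exact h0 (n + 1)
    · have hn0 : (0 : ℝ) < n := by exact_mod_cast hm.trans_le hn
      have h1 := mul_le_mul_of_nonneg_left (ih (e + 1)) (sub_nonneg.2 (hq n).2)
      have h2 := mul_le_mul_of_nonneg_left (ih e) (hq n).1
      rw [degSum_succ _ _ (by omega), show m + (e + 1) - 1 = m + e by omega]
      refine (add_le_add h1 h2).trans ?_
      rw [Finset.sum_range_succ, Real.exp_add]
      set B := Real.exp (∑ j ∈ Finset.range n, ε j / (j + 1))
      have hB0 : 0 < B := Real.exp_pos _
      have h3 : q n * (1 - x) * n = x * (1 + ε n) := by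
        rw [hqm n hn]; field_simp; linear_combination (1 + ε n) * hrx
      -- One time step adds `x (1 + ε n)` instead of `x`; the excess is paid by one more factor of
      -- the exponential.
      have h4 : (n : ℝ) + 1 + ε n ≤ Real.exp (ε n / (n + 1)) * (n + 1) := by
        have := Real.add_one_le_exp (ε n / (n + 1))
        calc (n : ℝ) + 1 + ε n = (ε n / (n + 1) + 1) * (n + 1) := by field_simp; ring
          _ ≤ _ := by gcongr
      calc _ = B * x ^ e * (x * n + q n * (1 - x) * n) := by ring
        _ = B * x ^ (e + 1) * (n + 1 + ε n) := by rw [h3]; ring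
        _ ≤ B * x ^ (e + 1) * (Real.exp (ε n / (n + 1)) * (n + 1)) := by gcongr
        _ = _ := by push_cast; ring

/-- If the success probabilities are `r / j` up to a factor `1 - ε j`, then `degSum` is at least
the exact solution `n * x ^ d`, with `x = r / (1 + r)`, up to a factor independent of `r` and
a correction for the trials before time `m`. -/
theorem le_degSum_of_le {q ε : ℕ → ℝ} {r x y s : ℝ} {m : ℕ} (hm : 0 < m)
    (hq : ∀ j, q j ∈ Set.Icc 0 1) (hε : ∀ j, 0 ≤ ε j) (hr : 0 ≤ r) (hx0 : 0 ≤ x)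
    (hrx : r * (1 - x) = x) (hxy : x ≤ y) (hy1 : y ≤ 1) (hs : 0 ≤ s) (hrs : r * (1 - y) = s * y)
    (hqm : ∀ j, m ≤ j → q j = r * (1 - ε j) / j) {n : ℕ} (hn : m ≤ n) (d : ℕ) :
    (1 - ∑ j ∈ Finset.Ico m n, ε j / (j + 1)) * n * x ^ d -
      m * Real.exp (s * ∑ j ∈ Finset.range n, (j : ℝ)⁻¹) * y ^ d ≤ degSum q n d := by
  have hy0 : 0 ≤ y := hx0.trans hxy
  have hsum : ∀ n, 0 ≤ ∑ j ∈ Finset.Ico m n, ε j / ((j : ℝ) + 1) := fun n =>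
    Finset.sum_nonneg fun j _ => div_nonneg (hε j) (by positivity)
  have hE : ∀ n, (1 : ℝ) ≤ Real.exp (s * ∑ j ∈ Finset.range n, (j : ℝ)⁻¹) := fun n =>
    Real.one_le_exp (mul_nonneg hs (Finset.sum_nonneg fun j _ => by positivity))
  induction n, hn using Nat.le_induction generalizing d with
  | base =>
    -- At time `m` the correction already exceeds the main term, since `x ≤ y`, so the claimed lower
    -- bound is nonpositive.
    refine le_trans ?_ (degSum_nonneg hq m d)
    have h1 : x ^ d ≤ y ^ d := by gcongr
    have h2 : y ^ d ≤ Real.exp (s * ∑ j ∈ Finset.range m, (j : ℝ)⁻¹) * y ^ d :=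
      le_mul_of_one_le_left (by positivity) (hE m)
    have h3 : (0 : ℝ) ≤ m := Nat.cast_nonneg m
    have := mul_le_mul_of_nonneg_left (h1.trans h2) h3
    simp only [Finset.Ico_self, Finset.sum_empty, sub_zero, one_mul]
    linarith
  | succ n hn ih =>
    rcases d with _ | d
    · simp only [pow_zero, mul_one, degSum_zero_right]
      have h1 := hsum (n + 1)
      have h2 : (0 : ℝ) ≤ (n + 1 : ℕ) := Nat.cast_nonneg _
      have h3 : 0 ≤ m * Real.exp (s * ∑ j ∈ Finset.range (n + 1), (j : ℝ)⁻¹) := by positivity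
      nlinarith
    · have hn0 : (0 : ℝ) < n := by exact_mod_cast hm.trans_le hn
      have h1 := mul_le_mul_of_nonneg_left (ih (d + 1)) (sub_nonneg.2 (hq n).2)
      have h2 := mul_le_mul_of_nonneg_left (ih d) (hq n).1
      rw [degSum_succ _ _ (by omega), show d + 1 - 1 = d by omega]
      refine le_trans ?_ (add_le_add h1 h2)
      rw [Finset.sum_range_succ, Finset.sum_Ico_succ_top hn, mul_add, Real.exp_add]
      have hb := hsum n
      set b := ∑ j ∈ Finset.Ico m n, ε j / ((j : ℝ) + 1)
      set E := Real.exp (s * ∑ j ∈ Finset.range n, (j : ℝ)⁻¹)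
      have hE0 : 0 < E := Real.exp_pos _
      have h3 : q n * (1 - x) * n = x * (1 - ε n) := by
        rw [hqm n hn]; field_simp; linear_combination (1 - ε n) * hrx
      -- The correction is a supersolution of the recursion: one step multiplies `y ^ d` by at most
      -- `1 + s / n`, with `s` fixed by `r (1 - y) = s y`.
      have h4 : y + q n * (1 - y) ≤ y * Real.exp (s * (n : ℝ)⁻¹) := by
        have h5 := Real.add_one_le_exp (s * (n : ℝ)⁻¹)
        have h6 : q n ≤ r / n := by
          rw [hqm n hn]
          gcongr
          nlinarith [mul_nonneg hr (hε n)]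
        calc y + q n * (1 - y) ≤ y + r / n * (1 - y) := by
              have := sub_nonneg.2 hy1
              gcongr
          _ = y * (s * (n : ℝ)⁻¹ + 1) := by
              field_simp; linear_combination hrs
          _ ≤ _ := by gcongr
      have h7 : (1 - (b + ε n / (n + 1))) * (n + 1) ≤ (1 - b) * (n + 1 - ε n) := by
        have : ε n / (n + 1) * (n + 1) = ε n := by field_simp
        nlinarith [mul_nonneg hb (hε n)]
      calc _ = (1 - (b + ε n / (n + 1))) * (n + 1) * x ^ (d + 1) -
              m * E * y ^ d * (y * Real.exp (s * (n : ℝ)⁻¹)) := by push_cast; ring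
        _ ≤ (1 - b) * (n + 1 - ε n) * x ^ (d + 1) - m * E * y ^ d * (y + q n * (1 - y)) := by
            gcongr
        _ = (1 - b) * x ^ d * (x * n + x * (1 - ε n)) - m * E * y ^ d * (y + q n * (1 - y)) := by
            ring
        _ = _ := by rw [← h3]; ring

/-! ### Negative dependence of the in-degrees -/

/-- A Bernoulli-type inequality: the first-order expansion in `δ` underestimates the product. It
matches the one-step recursion for joint events, where the new vertex picks at most one target, to
the product of the one-vertex recursions. -/
theorem prod_sub_sum_mul_le_prod_sub {ι : Type*} [DecidableEq ι] (I : Finset ι) (f δ : ι → ℝ)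
    (h0 : ∀ i ∈ I, 0 ≤ δ i) (h1 : ∀ i ∈ I, δ i ≤ f i) :
    ∏ i ∈ I, f i - ∑ i ∈ I, δ i * ∏ k ∈ I.erase i, f k ≤ ∏ i ∈ I, (f i - δ i) := by
  induction I using Finset.induction_on with
  | empty => simp
  | insert j I hj ih =>
    have ih := ih (fun i hi => h0 i (Finset.mem_insert_of_mem hi))
      fun i hi => h1 i (Finset.mem_insert_of_mem hi)
    have hj0 := h0 j (Finset.mem_insert_self _ _)
    have hj1 := sub_nonneg.2 (h1 j (Finset.mem_insert_self _ _))
    have hs : ∑ i ∈ I, δ i * ∏ k ∈ (insert j I).erase i, f k =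
        f j * ∑ i ∈ I, δ i * ∏ k ∈ I.erase i, f k := by
      rw [Finset.mul_sum]
      refine Finset.sum_congr rfl fun i hi => ?_
      have hij : j ≠ i := fun h => hj (h ▸ hi)
      rw [Finset.erase_insert_of_ne hij, Finset.prod_insert (by simp [hj])]
      ring
    have hs0 : 0 ≤ ∑ i ∈ I, δ i * ∏ k ∈ I.erase i, f k :=
      Finset.sum_nonneg fun i hi => mul_nonneg (h0 i (Finset.mem_insert_of_mem hi)) <|
        Finset.prod_nonneg fun k hk => by
          have hk' := Finset.mem_insert_of_mem (b := j) (Finset.mem_of_mem_erase hk)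
          exact (h0 k hk').trans (h1 k hk')
    rw [Finset.prod_insert hj, Finset.prod_insert hj, Finset.sum_insert hj,
      Finset.erase_insert hj, hs]
    nlinarith [mul_le_mul_of_nonneg_left ih hj1, mul_nonneg hj0 hs0]

@[simp]
theorem inDegree_zero (a : ℕ → ℕ) (i : ℕ) : inDegree a 0 i = 0 := by simp [inDegree]

@[simp]
theorem inDegree_one (a : ℕ → ℕ) (i : ℕ) : inDegree a 1 i = 0 := by simp [inDegree]

theorem inDegree_succ (a : ℕ → ℕ) {n : ℕ} (hn : 0 < n) (i : ℕ) :
    inDegree a (n + 1) i = inDegree a n i + if a n = i then 1 else 0 := by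
  unfold inDegree
  rw [← Finset.insert_Ico_right_eq_Ico_add_one (by omega), Finset.filter_insert]
  split_ifs <;> simp

theorem inDegree_congr {a b : ℕ → ℕ} {n : ℕ} (h : ∀ j < n, a j = b j) (i : ℕ) :
    inDegree a n i = inDegree b n i := by
  unfold inDegree
  congr 1
  refine Finset.filter_congr fun j hj => ?_
  rw [h j (Finset.mem_Ico.1 hj).2]

/-- The event that each vertex `i ∈ I` has in-degree less than `t i` in the tree on `n` vertices. -/
def degLT (I : Finset ℕ) (n : ℕ) (t : ℕ → ℕ) : Set (ℕ → ℕ) :=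
  {a | ∀ i ∈ I, inDegree a n i < t i}

theorem measurable_inDegree (n i : ℕ) : Measurable fun a : ℕ → ℕ => inDegree a n i := by
  induction n with
  | zero => simp
  | succ n ih =>
    rcases Nat.eq_zero_or_pos n with rfl | hn
    · simp
    · simp only [inDegree_succ _ hn]
      refine ih.add (Measurable.ite ?_ measurable_const measurable_const)
      exact measurableSet_eq_fun (measurable_pi_apply n) measurable_const

theorem measurableSet_degLT (I : Finset ℕ) (n : ℕ) (t : ℕ → ℕ) :
    MeasurableSet (degLT I n t) := by
  have : degLT I n t = ⋂ i ∈ I, {a | inDegree a n i < t i} := by ext; simp [degLT]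
  rw [this]
  exact Finset.measurableSet_biInter _ fun i _ =>
    measurableSet_lt (measurable_inDegree n i) measurable_const

/-- An event determined by the coordinates below `n` factors through the restriction to `range n`
(extended by zeros), which is independent of coordinate `n`. -/
theorem measureReal_inter_eval {κ : ℕ → Measure ℕ} [∀ j, IsProbabilityMeasure (κ j)]
    (n : ℕ) (s : Set ℕ) {E : Set (ℕ → ℕ)} (hE : MeasurableSet E)
    (hdep : ∀ a b : ℕ → ℕ, (∀ j < n, a j = b j) → a ∈ E → b ∈ E) :
    (Measure.infinitePi κ).real ({a | a n ∈ s} ∩ E) =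
      (κ n).real s * (Measure.infinitePi κ).real E := by
  have hind : iIndepFun (fun (j : ℕ) (a : ℕ → ℕ) => a j) (Measure.infinitePi κ) :=
    iIndepFun_infinitePi (X := fun _ => id) (fun _ => measurable_id)
  have h := hind.indepFun_finset {n} (Finset.range n) (by simp) fun j => measurable_pi_apply j
  let ext : ((i : Finset.range n) → ℕ) → ℕ → ℕ := fun b j =>
    if hj : j ∈ Finset.range n then b ⟨j, hj⟩ else 0
  have hext : Measurable ext := by
    refine measurable_pi_lambda _ fun j => ?_
    by_cases hj : j ∈ Finset.range n
    · simp only [ext, hj, dite_true]; exact measurable_pi_apply _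
    · simp only [ext, hj, dite_false]; exact measurable_const
  have h1 : {a : ℕ → ℕ | a n ∈ s} = (fun (a : ℕ → ℕ) (i : ({n} : Finset ℕ)) => a i) ⁻¹'
      ((fun b => b ⟨n, by simp⟩) ⁻¹' s) := by ext; simp
  have h2 : E = (fun (a : ℕ → ℕ) (i : Finset.range n) => a i) ⁻¹' (ext ⁻¹' E) := by
    ext a
    simp only [Set.mem_preimage]
    constructor <;> refine hdep _ _ fun j hj => ?_ <;> simp [ext, hj]
  have h3 := h.measure_inter_preimage_eq_mul ((fun b => b ⟨n, by simp⟩) ⁻¹' s) (ext ⁻¹' E)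
    ((measurable_pi_apply _) (MeasurableSet.of_discrete)) (hext hE)
  rw [← h1, ← h2] at h3
  rw [measureReal_def, h3, ENNReal.toReal_mul]
  congr 1
  exact (measurePreserving_eval_infinitePi κ n).measureReal_preimage
    (MeasurableSet.of_discrete (s := s)).nullMeasurableSet

/-- Splitting by the target of vertex `n`: an edge to `k ∈ I` uses up one unit of the threshold of
`k`. -/
theorem degLT_succ (I : Finset ℕ) {n : ℕ} (hn : 0 < n) (t : ℕ → ℕ) :
    degLT I (n + 1) t =
      (⋃ k ∈ I, {a : ℕ → ℕ | a n ∈ ({k} : Set ℕ)} ∩ degLT I n (Function.update t k (t k - 1))) ∪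
        {a : ℕ → ℕ | a n ∈ ((I : Set ℕ)ᶜ)} ∩ degLT I n t := by
  ext a
  simp only [degLT, Set.mem_ofPred_eq, inDegree_succ _ hn, Set.mem_union, Set.mem_iUnion,
    Set.mem_inter_iff, Set.mem_singleton_iff, Set.mem_compl_iff, Finset.mem_coe, exists_prop]
  by_cases ha : a n ∈ I
  · simp only [ha, not_true_eq_false, false_and, or_false]
    have : ∀ i, inDegree a n i < Function.update t (a n) (t (a n) - 1) i ↔
        (inDegree a n i + if a n = i then 1 else 0) < t i := fun i => by
      by_cases hi : a n = i
      -- Truncated subtraction is harmless: for threshold `0` both conditions are impossible.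
      · subst hi; simp; omega
      · simp [hi, Function.update_of_ne (Ne.symm hi)]
    constructor
    · exact fun h => ⟨a n, ha, rfl, fun i hi => (this i).2 (h i hi)⟩
    · rintro ⟨k, -, rfl, h⟩ i hi
      exact (this i).1 (h i hi)
  · simp only [ha, not_false_eq_true, true_and]
    have h1 : ∀ i ∈ I, a n ≠ i := fun i hi h => ha (h ▸ hi)
    constructor
    · exact fun h => Or.inr fun i hi => by simpa [h1 i hi] using h i hi
    · rintro (⟨k, hk, h, -⟩ | h) i hi
      · exact (h1 k hk h).elim
      · simpa [h1 i hi] using h i hi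

theorem degLT_congr {I : Finset ℕ} {n : ℕ} {t : ℕ → ℕ} (a b : ℕ → ℕ) (h : ∀ j < n, a j = b j)
    (ha : a ∈ degLT I n t) : b ∈ degLT I n t := fun i hi => by
  rw [← inDegree_congr h]; exact ha i hi

theorem measureReal_degLT_succ {κ : ℕ → Measure ℕ} [∀ j, IsProbabilityMeasure (κ j)]
    (I : Finset ℕ) {n : ℕ} (hn : 0 < n) (t : ℕ → ℕ) :
    (Measure.infinitePi κ).real (degLT I (n + 1) t) =
      ∑ k ∈ I, (κ n).real {k} *
        (Measure.infinitePi κ).real (degLT I n (Function.update t k (t k - 1))) +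
      (1 - ∑ k ∈ I, (κ n).real {k}) * (Measure.infinitePi κ).real (degLT I n t) := by
  have hm : ∀ s : Set ℕ, MeasurableSet {a : ℕ → ℕ | a n ∈ s} := fun s =>
    measurable_pi_apply n (MeasurableSet.of_discrete (s := s))
  rw [degLT_succ I hn, measureReal_union _ ((hm _).inter (measurableSet_degLT _ _ _))
      (measure_ne_top _ _) (measure_ne_top _ _),
    measureReal_biUnion_finset]
  · congr 1
    · exact Finset.sum_congr rfl fun k _ =>
        measureReal_inter_eval n _ (measurableSet_degLT _ _ _) degLT_congr
    · rw [measureReal_inter_eval n _ (measurableSet_degLT _ _ _) degLT_congr,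
        probReal_compl_eq_one_sub (Finset.measurableSet I), sum_measureReal_singleton]
  · intro k _ l _ hkl
    refine Set.disjoint_left.2 fun a ha hb => hkl ?_
    exact (Set.mem_singleton_iff.1 ha.1).symm.trans (Set.mem_singleton_iff.1 hb.1)
  · exact fun k _ => (hm _).inter (measurableSet_degLT _ _ _)
  · refine Set.disjoint_left.2 fun a ha hb => ?_
    simp only [Set.mem_iUnion, Set.mem_inter_iff, exists_prop] at ha
    obtain ⟨k, hk, h, -⟩ := ha
    have h : a n = k := h
    exact hb.1 (by rw [h]; exact hk)

/-- The success probabilities of the trials whose sum is the in-degree of `i`. -/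
noncomputable def attachProb (κ : ℕ → Measure ℕ) (i j : ℕ) : ℝ :=
  if 0 < j then (κ j).real {i} else 0

theorem attachProb_mem_Icc (κ : ℕ → Measure ℕ) [∀ j, IsProbabilityMeasure (κ j)] (i j : ℕ) :
    attachProb κ i j ∈ Set.Icc (0 : ℝ) 1 := by
  unfold attachProb
  split_ifs
  · exact ⟨measureReal_nonneg, measureReal_le_one⟩
  · simp

theorem measureReal_degLT_singleton (κ : ℕ → Measure ℕ) [∀ j, IsProbabilityMeasure (κ j)]
    (i n : ℕ) (t : ℕ → ℕ) :
    (Measure.infinitePi κ).real (degLT {i} n t) = 1 - binTail (attachProb κ i) n (t i) := by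
  induction n generalizing t with
  | zero =>
    by_cases h : t i = 0 <;> simp [degLT, binTail, h, Nat.pos_iff_ne_zero]
  | succ n ih =>
    rcases Nat.eq_zero_or_pos n with rfl | hn
    -- The trial at time `0` belongs to the root, which sends no edge; `attachProb` vanishes there.
    · by_cases h : t i = 0 <;>
        simp [degLT, binTail, h, attachProb, Nat.pos_iff_ne_zero]
    · rw [measureReal_degLT_succ _ hn, binTail_succ, ih]
      simp only [Finset.sum_singleton, ih, Function.update_self, attachProb, hn, if_true]
      ring

/-- The in-degrees are negatively dependent. -/
theorem measureReal_degLT_le_prod (κ : ℕ → Measure ℕ) [∀ j, IsProbabilityMeasure (κ j)]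
    (I : Finset ℕ) (n : ℕ) (t : ℕ → ℕ) :
    (Measure.infinitePi κ).real (degLT I n t) ≤
      ∏ i ∈ I, (1 - binTail (attachProb κ i) n (t i)) := by
  have hp := attachProb_mem_Icc κ
  induction n generalizing t with
  | zero =>
    by_cases h : ∀ i ∈ I, t i ≠ 0
    · rw [Finset.prod_eq_one fun i hi => by simp [binTail, h i hi]]
      exact measureReal_le_one
    · push Not at h
      obtain ⟨i, hi, h⟩ := h
      have : degLT I 0 t = ∅ := by
        ext a; simp only [degLT, Set.mem_ofPred_eq, Set.mem_empty_iff_false, iff_false]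
        exact fun H => by simpa [h] using H i hi
      rw [this, measureReal_empty]
      exact Finset.prod_nonneg fun i _ => sub_nonneg.2 (binTail_le_one (hp i) _ _)
  | succ n ih =>
    rcases Nat.eq_zero_or_pos n with rfl | hn
    · have h1 : degLT I (0 + 1) t = degLT I 0 t := by ext; simp [degLT]
      rw [h1]
      refine (ih t).trans_eq (Finset.prod_congr rfl fun i _ => ?_)
      simp [binTail_succ, attachProb]
    · rw [measureReal_degLT_succ _ hn]
      set q : ℕ → ℝ := fun k => (κ n).real {k} with hq
      set f : ℕ → ℝ := fun k => 1 - binTail (attachProb κ k) n (t k) with hf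
      set g : ℕ → ℝ := fun k => 1 - binTail (attachProb κ k) n (t k - 1) with hg
      have hg0 : ∀ k, 0 ≤ g k := fun k => sub_nonneg.2 (binTail_le_one (hp k) _ _)
      have hgf : ∀ k, g k ≤ f k := fun k => sub_le_sub_left (binTail_le_pred (hp k) _ _) _
      have hq0 : ∀ k, 0 ≤ q k := fun k => measureReal_nonneg
      have hq1 : ∀ k, q k ≤ 1 := fun k => measureReal_le_one
      have hsum : ∑ k ∈ I, q k ≤ 1 := by
        rw [sum_measureReal_singleton]; exact measureReal_le_one
      have hup : ∀ k ∈ I, (Measure.infinitePi κ).real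
          (degLT I n (Function.update t k (t k - 1))) ≤ g k * ∏ l ∈ I.erase k, f l := by
        intro k hk
        refine (ih _).trans_eq ?_
        rw [← Finset.mul_prod_erase I _ hk]
        simp only [Function.update_self]
        congr 1
        refine Finset.prod_congr rfl fun l hl => ?_
        rw [Function.update_of_ne (Finset.ne_of_mem_erase hl)]
      have hrhs : ∏ i ∈ I, (1 - binTail (attachProb κ i) (n + 1) (t i)) =
          ∏ i ∈ I, (f i - q i * (f i - g i)) := by
        refine Finset.prod_congr rfl fun i _ => ?_
        simp only [binTail_succ, attachProb, hn, if_true, hf, hg, hq]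
        ring
      rw [hrhs]
      -- The induction hypothesis bounds the left side by `∏ f - ∑ q k (f k - g k) ∏_{l ≠ k} f l`,
      -- the first-order expansion of the product on the right.
      refine le_trans ?_ (prod_sub_sum_mul_le_prod_sub I f (fun k => q k * (f k - g k))
        (fun k _ => mul_nonneg (hq0 k) (sub_nonneg.2 (hgf k))) fun k _ => ?_)
      · refine (add_le_add (Finset.sum_le_sum fun k hk =>
          mul_le_mul_of_nonneg_left (hup k hk) (hq0 k))
          (mul_le_mul_of_nonneg_left (ih t) (sub_nonneg.2 hsum))).trans_eq ?_
        have : ∑ k ∈ I, q k * (f k - g k) * ∏ l ∈ I.erase k, f l =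
            ∑ k ∈ I, q k * ∏ l ∈ I, f l - ∑ k ∈ I, q k * (g k * ∏ l ∈ I.erase k, f l) := by
          rw [← Finset.sum_sub_distrib]
          refine Finset.sum_congr rfl fun k hk => ?_
          rw [← Finset.mul_prod_erase I _ hk]
          ring
        rw [this, ← Finset.sum_mul]
        ring
      · nlinarith [hq0 k, hq1 k, hg0 k, hgf k]

/-! ### Weight laws and association inequalities -/

/-- The assumptions on the weight distribution: it is carried by `(0, 1]`, and `1` is the essential
supremum. -/
structure IsWeightLaw (ν : Measure ℝ) : Prop where
  ae_mem : ∀ᵐ x ∂ν, x ∈ Set.Ioc (0 : ℝ) 1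
  measure_Ici_pos : ∀ v < 1, 0 < ν.real (Set.Ici v)

theorem isWeightLaw_of_sSup_eq_one {ν : Measure ℝ} [IsProbabilityMeasure ν]
    (hpos : ∀ᵐ x ∂ν, 0 < x) (hsup : sSup {x : ℝ | 0 < x ∧ ν (Set.Iic x) < 1} = 1) :
    IsWeightLaw ν := by
  set S := {x : ℝ | 0 < x ∧ ν (Set.Iic x) < 1} with hS
  -- The supremum of an unbounded or empty set of reals is `0` by convention, so the value `1`
  -- excludes both cases.
  have hbdd : BddAbove S := by
    by_contra h
    rw [Real.sSup_of_not_bddAbove h] at hsup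
    norm_num at hsup
  have hne : S.Nonempty := by
    by_contra h
    rw [Set.not_nonempty_iff_eq_empty.1 h, Real.sSup_empty] at hsup
    norm_num at hsup
  refine ⟨?_, fun v hv => ?_⟩
  · have h1 : ∀ᵐ x ∂ν, ∀ k : ℕ, x ≤ 1 + 1 / ((k : ℝ) + 1) := by
      rw [ae_all_iff]
      intro k
      have hk : (0 : ℝ) < 1 / ((k : ℝ) + 1) := by positivity
      have h2 : 1 + 1 / ((k : ℝ) + 1) ∉ S := fun h => by
        have := le_csSup hbdd h
        linarith
      have h3 : ν (Set.Iic (1 + 1 / ((k : ℝ) + 1))) = 1 := by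
        refine le_antisymm prob_le_one (not_lt.1 fun h => h2 ⟨by positivity, h⟩)
      exact (mem_ae_iff_prob_eq_one measurableSet_Iic).2 h3
    filter_upwards [hpos, h1] with x hx0 hx1
    refine ⟨hx0, le_of_forall_pos_le_add fun ε hε => ?_⟩
    obtain ⟨k, hk⟩ := exists_nat_one_div_lt hε
    exact (hx1 k).trans (by linarith)
  · obtain ⟨y, ⟨-, hy1⟩, hvy⟩ := exists_lt_of_lt_csSup hne (hsup.symm ▸ hv)
    have h : ν (Set.Ioi y) ≠ 0 := by
      rw [← Set.compl_Iic, prob_compl_eq_one_sub measurableSet_Iic]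
      exact (tsub_pos_of_lt hy1).ne'
    have h2 : 0 < ν.real (Set.Ioi y) := ENNReal.toReal_pos h (measure_ne_top _ _)
    exact h2.trans_le (measureReal_mono fun z hz => (hvy.trans hz).le)

variable {ν : Measure ℝ} [IsProbabilityMeasure ν]

theorem IsWeightLaw.integrable_id (h : IsWeightLaw ν) : Integrable (fun x : ℝ => x) ν :=
  Integrable.of_mem_Icc 0 1 measurable_id.aemeasurable
    (h.ae_mem.mono fun _ hx => ⟨hx.1.le, hx.2⟩)

theorem IsWeightLaw.mean_mem (h : IsWeightLaw ν) : theta ν - 1 ∈ Set.Ioc (0 : ℝ) 1 := by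
  have h0 : theta ν - 1 = ∫ x, x ∂ν := by simp [theta]
  rw [h0]
  constructor
  · refine integral_pos_iff_support_of_nonneg_ae (h.ae_mem.mono fun _ hx => hx.1.le)
      h.integrable_id |>.2 ?_
    have : ∀ᵐ x ∂ν, x ∈ Function.support fun x : ℝ => x := h.ae_mem.mono fun x hx => hx.1.ne'
    exact ((measure_congr (eventuallyEq_univ.2 this)).trans measure_univ).symm ▸ one_pos
  · calc ∫ x, x ∂ν ≤ ∫ _, (1 : ℝ) ∂ν :=
          integral_mono_ae h.integrable_id (integrable_const _) (h.ae_mem.mono fun _ hx => hx.2)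
      _ = 1 := by simp

/-- Chebyshev's association inequality. -/
theorem integral_mul_integral_le_of_monotoneOn {f g : ℝ → ℝ} {s : Set ℝ} (hs : ∀ᵐ x ∂ν, x ∈ s)
    (hf : MonotoneOn f s) (hg : MonotoneOn g s) (hfi : Integrable f ν) (hgi : Integrable g ν)
    (hfg : Integrable (fun x => f x * g x) ν) :
    (∫ x, f x ∂ν) * ∫ x, g x ∂ν ≤ ∫ x, f x * g x ∂ν := by
  -- For an independent copy `y` of `x`, `(f x - f y) (g x - g y) ≥ 0`; this is integrated first in
  -- `x`, then in `y`.
  have h1 : ∀ y ∈ s, 0 ≤ ∫ x, f x * g x ∂ν - g y * ∫ x, f x ∂ν - f y * ∫ x, g x ∂ν +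
      f y * g y := fun y hy => by
    have h2 : 0 ≤ ∫ x, (f x - f y) * (g x - g y) ∂ν := by
      refine integral_nonneg_of_ae (hs.mono fun x hx => ?_)
      rcases le_total x y with h | h
      · exact mul_nonneg_of_nonpos_of_nonpos (sub_nonpos.2 (hf hx hy h))
          (sub_nonpos.2 (hg hx hy h))
      · exact mul_nonneg (sub_nonneg.2 (hf hy hx h)) (sub_nonneg.2 (hg hy hx h))
    have h3 : ∫ x, (f x - f y) * (g x - g y) ∂ν =
        ∫ x, (f x * g x - g y * f x - f y * g x + f y * g y) ∂ν := by
      congr 1; ext x; ring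
    rw [h3, integral_add, integral_sub, integral_sub, integral_const_mul, integral_const_mul] at h2
    · simpa using h2
    · exact hfg
    · exact hfi.const_mul _
    · exact hfg.sub (hfi.const_mul _)
    · exact hgi.const_mul _
    · exact (hfg.sub (hfi.const_mul _)).sub (hgi.const_mul _)
    · exact integrable_const _
  have h4 := integral_nonneg_of_ae (hs.mono h1)
  rw [integral_add, integral_sub, integral_sub, integral_mul_const, integral_mul_const] at h4
  · simp only [integral_const, probReal_univ, one_smul] at h4
    nlinarith
  · exact integrable_const _
  · exact hgi.mul_const _
  · exact (integrable_const _).sub (hgi.mul_const _)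
  · exact hfi.mul_const _
  · exact ((integrable_const _).sub (hgi.mul_const _)).sub (hfi.mul_const _)
  · exact hfg

/-- The success probability of the geometric limit law of the degree of a vertex of weight `x`. -/
noncomputable def ratio (ν : Measure ℝ) (x : ℝ) : ℝ := x / (theta ν - 1 + x)

theorem tailProb_eq {ν : Measure ℝ} (k : ℕ) : tailProb ν k = ∫ x, ratio ν x ^ k ∂ν := rfl

theorem measurable_ratio {ν : Measure ℝ} : Measurable (ratio ν) := by unfold ratio; fun_prop

theorem IsWeightLaw.ratio_mem (h : IsWeightLaw ν) {x : ℝ} (hx : 0 < x) :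
    ratio ν x ∈ Set.Ioc (0 : ℝ) 1 := by
  have := h.mean_mem.1
  unfold ratio
  exact ⟨by positivity, (div_le_one (by positivity)).2 (by linarith)⟩

theorem IsWeightLaw.monotoneOn_ratio (h : IsWeightLaw ν) :
    MonotoneOn (ratio ν) (Set.Ioc 0 1) := by
  intro x hx y hy hxy
  have h0 := h.mean_mem.1
  have hx0 := hx.1
  have hy0 := hy.1
  unfold ratio
  rw [div_le_div_iff₀ (by positivity) (by positivity)]
  nlinarith

theorem IsWeightLaw.monotoneOn_ratio_pow (h : IsWeightLaw ν) (k : ℕ) :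
    MonotoneOn (fun x => ratio ν x ^ k) (Set.Ioc 0 1) := fun _ hx _ hy hxy =>
  pow_le_pow_left₀ (h.ratio_mem hx.1).1.le (h.monotoneOn_ratio hx hy hxy) k

theorem IsWeightLaw.integrable_ratio_pow (h : IsWeightLaw ν) (k : ℕ) :
    Integrable (fun x => ratio ν x ^ k) ν := by
  refine Integrable.of_mem_Icc 0 1 (measurable_ratio.pow_const k).aemeasurable
    (h.ae_mem.mono fun x hx => ?_)
  have := h.ratio_mem hx.1
  exact ⟨pow_nonneg this.1.le k, pow_le_one₀ this.1.le this.2⟩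

theorem IsWeightLaw.tailProb_pos (h : IsWeightLaw ν) (k : ℕ) : 0 < tailProb ν k := by
  refine integral_pos_iff_support_of_nonneg_ae
    (h.ae_mem.mono fun x hx => pow_nonneg (h.ratio_mem hx.1).1.le k)
    (h.integrable_ratio_pow k) |>.2 ?_
  have : ∀ᵐ x ∂ν, x ∈ Function.support fun x : ℝ => ratio ν x ^ k :=
    h.ae_mem.mono fun x hx => (pow_pos (h.ratio_mem hx.1).1 k).ne'
  change 0 < ν (Function.support fun x : ℝ => ratio ν x ^ k)
  exact ((measure_congr (eventuallyEq_univ.2 this)).trans measure_univ).symm ▸ one_pos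

/-- Powers of `ratio ν` are increasing functions of the same variable, hence positively correlated.
Lowering the exponent by a fixed `m` therefore costs only a constant factor. -/
theorem IsWeightLaw.tailProb_mul_le (h : IsWeightLaw ν) (k m : ℕ) :
    tailProb ν k * tailProb ν m ≤ tailProb ν (k + m) := by
  have := integral_mul_integral_le_of_monotoneOn h.ae_mem (h.monotoneOn_ratio_pow k)
    (h.monotoneOn_ratio_pow m) (h.integrable_ratio_pow k) (h.integrable_ratio_pow m)
    (by simpa only [← pow_add] using h.integrable_ratio_pow (k + m))
  simpa only [← pow_add, tailProb_eq] using this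

/-- Association with the indicator of `[v, ∞)`: large weights carry a share of the moment that is
bounded below uniformly in `k`, so the lower bound can be restricted to them. -/
theorem IsWeightLaw.tailProb_mul_measureReal_le (h : IsWeightLaw ν) (k : ℕ) (v : ℝ) :
    tailProb ν k * ν.real (Set.Ici v) ≤ ∫ x in Set.Ici v, ratio ν x ^ k ∂ν := by
  have hi : ∀ x, ratio ν x ^ k * (Set.Ici v).indicator 1 x =
      (Set.Ici v).indicator (fun x => ratio ν x ^ k) x := fun x => by
    by_cases hx : x ∈ Set.Ici v <;> simp [hx]
  have := integral_mul_integral_le_of_monotoneOn (g := (Set.Ici v).indicator 1) h.ae_mem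
    (h.monotoneOn_ratio_pow k) (fun x _ y _ hxy => ?_) (h.integrable_ratio_pow k)
    ((integrable_const (1 : ℝ)).indicator measurableSet_Ici)
    (by simpa only [hi] using (h.integrable_ratio_pow k).indicator measurableSet_Ici)
  · simpa only [hi, integral_indicator_one measurableSet_Ici,
      integral_indicator measurableSet_Ici, tailProb_eq] using this
  · by_cases hx : v ≤ x
    · simp [hx, hx.trans hxy]
    · simp only [Set.indicator, Set.mem_Ici, hx, if_false]
      split_ifs <;> simp

/-! ### Concentration of the total weight -/

/-- The relative error in the law of large numbers for the total weight. -/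
noncomputable def err (j : ℕ) : ℝ := (j : ℝ) ^ (-(1 / 4) : ℝ)

theorem err_nonneg (j : ℕ) : 0 ≤ err j := Real.rpow_nonneg (Nat.cast_nonneg j) _

theorem err_le_one (j : ℕ) : err j ≤ 1 := by
  unfold err
  rcases Nat.eq_zero_or_pos j with rfl | hj
  · simp [Real.zero_rpow]
  · exact Real.rpow_le_one_of_one_le_of_nonpos (by exact_mod_cast hj) (by norm_num)

/-- Any positive decay exponent would do here. An exponent below `1/2` makes `err j ^ 2 * j` grow
like a power of `j`, as the deviation bounds need; `1/4` meets both demands. -/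
theorem summable_err_div : Summable fun j : ℕ => err j / ((j : ℝ) + 1) := by
  have h : Summable fun j : ℕ => (j : ℝ) ^ (-(5 / 4) : ℝ) :=
    Real.summable_nat_rpow.2 (by norm_num)
  refine Summable.of_nonneg_of_le (fun j => div_nonneg (err_nonneg j) (by positivity))
    (fun j => ?_) h
  rcases Nat.eq_zero_or_pos j with rfl | hj
  · simp [err, Real.zero_rpow]
  · have hj' : (0 : ℝ) < j := by exact_mod_cast hj
    calc err j / ((j : ℝ) + 1) ≤ err j / j := by
          have := err_nonneg j
          gcongr
          linarith
      _ = (j : ℝ) ^ (-(5 / 4) : ℝ) := by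
          rw [err, ← Real.rpow_sub_one hj'.ne']; norm_num

theorem err_sq_mul {j : ℕ} (hj : 0 < j) : err j ^ 2 * j = Real.sqrt j := by
  have hj' : (0 : ℝ) < j := by exact_mod_cast hj
  rw [err, ← Real.rpow_mul_natCast hj'.le, ← Real.rpow_add_one hj'.ne', Real.sqrt_eq_rpow]
  norm_num

/-- The weights for which the total weight of the first `j` vertices is close to its mean,
for all `j ≥ m`. -/
def goodWeights (ν : Measure ℝ) (m : ℕ) : Set (ℕ → ℝ) :=
  {w | (∀ i, w i ∈ Set.Ioc (0 : ℝ) 1) ∧ ∀ j ≥ m,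
    |∑ l ∈ Finset.range j, w l - (theta ν - 1) * j| ≤ err j / 2 * (theta ν - 1) * j}

theorem IsWeightLaw.ae_weights_mem (h : IsWeightLaw ν) :
    ∀ᵐ w ∂Measure.infinitePi fun _ : ℕ => ν, ∀ i, w i ∈ Set.Ioc (0 : ℝ) 1 :=
  ae_all_iff.2 fun i =>
    (measurePreserving_eval_infinitePi (fun _ : ℕ => ν) i).quasiMeasurePreserving.ae h.ae_mem

theorem integral_comp_eval_infinitePi {f : ℝ → ℝ} (hf : Measurable f) (i : ℕ) :
    ∫ w, f (w i) ∂(Measure.infinitePi fun _ : ℕ => ν) = ∫ x, f x ∂ν := by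
  conv_rhs => rw [← (measurePreserving_eval_infinitePi (fun _ : ℕ => ν) i).map_eq]
  exact (integral_map (measurable_pi_apply i).aemeasurable hf.aestronglyMeasurable).symm

/-- Hoeffding's inequality for variables in `[0, 1]`, with variance proxy `1/4`, applied to both
signs. -/
theorem IsWeightLaw.measureReal_deviation_le (h : IsWeightLaw ν) (j : ℕ) {t : ℝ} (ht : 0 ≤ t) :
    (Measure.infinitePi fun _ : ℕ => ν).real
      {w | t < |∑ l ∈ Finset.range j, w l - (theta ν - 1) * j|} ≤
      2 * Real.exp (-t ^ 2 / (2 * j * (1 / 4))) := by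
  set Q := Measure.infinitePi fun _ : ℕ => ν
  have hsub : ∀ i : ℕ, HasSubgaussianMGF (fun w : ℕ → ℝ => w i - (theta ν - 1))
      ((‖(1 : ℝ) - 0‖₊ / 2) ^ 2) Q := fun i => by
    have h1 := hasSubgaussianMGF_of_mem_Icc (μ := Q) (X := fun w : ℕ → ℝ => w i) (a := 0) (b := 1)
      (measurable_pi_apply i).aemeasurable
      (h.ae_weights_mem.mono fun w hw => ⟨(hw i).1.le, (hw i).2⟩)
    have h2 : ∫ w, w i ∂Q = theta ν - 1 := by
      rw [integral_comp_eval_infinitePi (f := fun x => x) measurable_id i]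
      simp [theta]
    rwa [h2] at h1
  have hind : iIndepFun (fun (i : ℕ) (w : ℕ → ℝ) => w i - (theta ν - 1)) Q :=
    iIndepFun_infinitePi (X := fun _ x => x - (theta ν - 1)) (fun _ => by fun_prop)
  have hind' : iIndepFun (fun (i : ℕ) (w : ℕ → ℝ) => -(w i - (theta ν - 1))) Q :=
    iIndepFun_infinitePi (X := fun _ x => -(x - (theta ν - 1))) (fun _ => by fun_prop)
  have h1 := HasSubgaussianMGF.measure_sum_range_ge_le_of_iIndepFun hind (n := j)
    (fun i _ => hsub i) ht
  have h2 := HasSubgaussianMGF.measure_sum_range_ge_le_of_iIndepFun hind' (n := j)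
    (fun i _ => (hsub i).neg) ht
  have hc : (((‖(1 : ℝ) - 0‖₊ / 2) ^ 2 : NNReal) : ℝ) = 1 / 4 := by norm_num
  rw [hc] at h1 h2
  rw [two_mul (Real.exp _)]
  refine (measureReal_mono ?_).trans ((measureReal_union_le _ _).trans (add_le_add h1 h2))
  intro w hw
  rw [Set.mem_ofPred_eq] at hw
  simp only [Finset.sum_neg_distrib, Finset.sum_sub_distrib, Finset.sum_const, Finset.card_range,
    nsmul_eq_mul, Set.mem_union, Set.mem_ofPred_eq]
  rcases lt_abs.1 hw with h | h
  · exact Or.inl (by linarith)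
  · exact Or.inr (by linarith)

theorem IsWeightLaw.summable_deviation (h : IsWeightLaw ν) :
    Summable fun j : ℕ => (Measure.infinitePi fun _ : ℕ => ν).real
      {w | err j / 2 * (theta ν - 1) * j <
        |∑ l ∈ Finset.range j, w l - (theta ν - 1) * j|} := by
  have hμ := h.mean_mem.1
  set μ := theta ν - 1
  have hs : Summable fun j : ℕ => 2 * 24 * (2 / μ ^ 2) ^ 4 * (1 / (j : ℝ) ^ 2) :=
    (Real.summable_one_div_nat_pow.2 (by norm_num)).mul_left _
  refine (summable_nat_add_iff 1).1 (Summable.of_nonneg_of_le (fun _ => measureReal_nonneg)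
    (fun k => ?_) ((summable_nat_add_iff 1).2 hs))
  have hj : 0 < k + 1 := k.succ_pos
  generalize k + 1 = j at hj
  have hj' : (0 : ℝ) < j := by exact_mod_cast hj
  refine (h.measureReal_deviation_le j (by have := err_nonneg j; positivity)).trans ?_
  set u := μ ^ 2 / 2 * Real.sqrt j with hu
  have hu0 : 0 < u := by positivity
  have h1 : -(err j / 2 * μ * j) ^ 2 / (2 * j * (1 / 4)) = -u := by
    rw [hu, ← err_sq_mul hj]; field_simp; ring
  have h2 : u ^ 4 = (μ ^ 2 / 2) ^ 4 * (j : ℝ) ^ 2 := by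
    rw [hu, mul_pow, show Real.sqrt j ^ 4 = (Real.sqrt j ^ 2) ^ 2 by ring, Real.sq_sqrt hj'.le]
  -- Since `u` is of order `√j`, the fourth power gives the summable bound `j ^ (-2)`.
  have h3 : u ^ 4 / 24 ≤ Real.exp u := by
    simpa [Nat.factorial] using Real.pow_div_factorial_le_exp u hu0.le 4
  rw [h1, Real.exp_neg]
  calc 2 * (Real.exp u)⁻¹ ≤ 2 * (u ^ 4 / 24)⁻¹ := by gcongr
    _ = _ := by rw [h2]; field_simp

theorem measurableSet_goodWeights {ν : Measure ℝ} (m : ℕ) : MeasurableSet (goodWeights ν m) := by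
  have : goodWeights ν m = (⋂ i, {w | w i ∈ Set.Ioc (0 : ℝ) 1}) ∩ ⋂ j, ⋂ _ : j ≥ m,
      {w | |∑ l ∈ Finset.range j, w l - (theta ν - 1) * j| ≤
        err j / 2 * (theta ν - 1) * j} := by
    ext w; simp [goodWeights]
  rw [this]
  refine (MeasurableSet.iInter fun i => measurable_pi_apply i measurableSet_Ioc).inter
    (MeasurableSet.iInter fun j => MeasurableSet.iInter fun _ => ?_)
  refine measurableSet_le ?_ measurable_const
  fun_prop

theorem IsWeightLaw.tendsto_measure_compl_goodWeights (h : IsWeightLaw ν) :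
    Tendsto (fun m => (Measure.infinitePi fun _ : ℕ => ν) (goodWeights ν m)ᶜ) atTop (𝓝 0) := by
  set Q := Measure.infinitePi fun _ : ℕ => ν
  have hbc := ae_eventually_notMem (μ := Q) (s := fun j : ℕ => {w | err j / 2 * (theta ν - 1) * j <
        |∑ l ∈ Finset.range j, w l - (theta ν - 1) * j|}) (by
    have := h.summable_deviation.tsum_ofReal_ne_top
    refine ne_of_eq_of_ne (tsum_congr fun j => ?_) this
    exact (ofReal_measureReal (measure_ne_top _ _)).symm)
  have h0 : Q (⋂ m, (goodWeights ν m)ᶜ) = 0 := by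
    have : ∀ᵐ w ∂Q, w ∉ ⋂ m, (goodWeights ν m)ᶜ := by
      filter_upwards [hbc, h.ae_weights_mem] with w hw hw'
      obtain ⟨m, hm⟩ := eventually_atTop.1 hw
      simp only [Set.mem_iInter, Set.mem_compl_iff, not_forall, not_not]
      exact ⟨m, hw', fun j hj => not_lt.1 (hm j hj)⟩
    simpa using measure_eq_zero_iff_ae_notMem.2 this
  rw [← h0]
  refine tendsto_measure_iInter_atTop
    (fun m => (measurableSet_goodWeights m).compl.nullMeasurableSet) ?_ ⟨0, measure_ne_top _ _⟩
  exact fun a b hab => Set.compl_subset_compl.2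
    fun w hw => ⟨hw.1, fun j hj => hw.2 j (hab.trans hj)⟩

/-! ### Comparison of the attachment probabilities with deterministic ones -/

/-- An upper bound for the probability that vertex `j` attaches to a given vertex of weight `v`,
for weights in `goodWeights ν m`. -/
noncomputable def upperProb (ν : Measure ℝ) (m : ℕ) (v : ℝ) (j : ℕ) : ℝ :=
  if j < m then 1 else v / (theta ν - 1) * (1 + err j) / j

/-- A lower bound for the probability that vertex `j` attaches to a given vertex of weight `v`,
for weights in `goodWeights ν m`. -/
noncomputable def lowerProb (ν : Measure ℝ) (m : ℕ) (v : ℝ) (j : ℕ) : ℝ :=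
  if j < m then 0 else v / (theta ν - 1) * (1 - err j) / j

theorem measurable_upperProb {ν : Measure ℝ} (m j : ℕ) :
    Measurable fun v => upperProb ν m v j := by
  unfold upperProb; split_ifs <;> fun_prop

theorem measurable_lowerProb {ν : Measure ℝ} (m j : ℕ) :
    Measurable fun v => lowerProb ν m v j := by
  unfold lowerProb; split_ifs <;> fun_prop

theorem measurable_binTail_after {p : ℝ → ℕ → ℝ} (hp : ∀ j, Measurable fun v => p v j)
    (i n d : ℕ) : Measurable fun v => binTail (after i (p v)) n d := by
  refine measurable_binTail (fun j => ?_) n d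
  unfold after
  split_ifs
  · exact hp j
  · exact measurable_const

theorem measurable_degSum {p : ℝ → ℕ → ℝ} (hp : ∀ j, Measurable fun v => p v j) (n d : ℕ) :
    Measurable fun v => degSum (p v) n d :=
  Finset.measurable_fun_sum _ fun i _ => measurable_binTail_after hp i n d

theorem IsWeightLaw.upperProb_mem_Icc (h : IsWeightLaw ν) {m : ℕ} (hm : 2 / (theta ν - 1) ≤ m)
    {v : ℝ} (hv : v ∈ Set.Ioc (0 : ℝ) 1) (j : ℕ) : upperProb ν m v j ∈ Set.Icc (0 : ℝ) 1 := by
  unfold upperProb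
  have hμ := h.mean_mem.1
  have he0 := err_nonneg j
  have he1 := err_le_one j
  have hv0 := hv.1
  split_ifs with hj
  · simp
  · have hj' : 2 / (theta ν - 1) ≤ j := hm.trans (by exact_mod_cast not_lt.1 hj)
    have hj0 : (0 : ℝ) < j := lt_of_lt_of_le (by positivity) hj'
    refine ⟨by positivity, ?_⟩
    rw [div_le_one hj0]
    -- Since `v ≤ 1` and `err j ≤ 1`, the numerator is at most `2 / μ`, hence at most `m`: this is
    -- the reason for the lower bound on `m`.
    refine le_trans ?_ hj'
    rw [div_mul_eq_mul_div]
    gcongr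
    nlinarith [hv.2]

theorem IsWeightLaw.lowerProb_mem_Icc (h : IsWeightLaw ν) {m : ℕ} (hm : 2 / (theta ν - 1) ≤ m)
    {v : ℝ} (hv : v ∈ Set.Ioc (0 : ℝ) 1) (j : ℕ) : lowerProb ν m v j ∈ Set.Icc (0 : ℝ) 1 := by
  have h1 := (h.upperProb_mem_Icc hm hv j)
  have hμ := h.mean_mem.1
  have he0 := err_nonneg j
  have he1 := sub_nonneg.2 (err_le_one j)
  have hv0 := hv.1
  unfold upperProb at h1
  unfold lowerProb
  split_ifs at h1 ⊢ with hj
  · simp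
  · refine ⟨by positivity, le_trans ?_ h1.2⟩
    gcongr
    linarith

theorem measureReal_parentLaw_singleton {w : ℕ → ℝ} (hw : ∀ i, 0 < w i) (i : ℕ) {j : ℕ}
    (hj : 0 < j) : (parentLaw w j).real {i} =
      if i < j then w i / ∑ l ∈ Finset.range j, w l else 0 := by
  classical
  have hS : 0 ≤ ∑ l ∈ Finset.range j, w l := Finset.sum_nonneg fun l _ => (hw l).le
  rw [measureReal_def, parentLaw, if_pos ⟨hj, fun i _ => hw i⟩]
  simp only [Measure.finsetSum_apply, Measure.smul_apply, smul_eq_mul,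
    Measure.dirac_apply' _ (measurableSet_singleton i), Set.indicator, Set.mem_singleton_iff,
    Pi.one_apply, mul_ite, mul_one, mul_zero, Finset.sum_ite_eq', Finset.mem_range]
  split_ifs
  · exact ENNReal.toReal_ofReal (div_nonneg (hw i).le hS)
  · simp

theorem attachProb_parentLaw {w : ℕ → ℝ} (hw : ∀ i, 0 < w i) (i j : ℕ) :
    attachProb (parentLaw w) i j =
      after i (fun j => w i / ∑ l ∈ Finset.range j, w l) j := by
  unfold attachProb after
  rcases Nat.eq_zero_or_pos j with rfl | hj
  · simp
  · rw [if_pos hj, measureReal_parentLaw_singleton hw i hj]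

theorem IsWeightLaw.attachProb_le (h : IsWeightLaw ν) {m : ℕ} {w : ℕ → ℝ}
    (hw : w ∈ goodWeights ν m) (i j : ℕ) :
    attachProb (parentLaw w) i j ≤ after i (upperProb ν m (w i)) j := by
  have hle := (attachProb_mem_Icc (parentLaw w) i j).2
  rw [attachProb_parentLaw fun i => (hw.1 i).1] at hle ⊢
  unfold after upperProb at *
  split_ifs at hle ⊢ with hij hj
  · exact hle
  · have hμ := h.mean_mem.1
    have he0 := err_nonneg j
    have he1 := err_le_one j
    have hj0 : (0 : ℝ) < j := by exact_mod_cast (by omega : 0 < j)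
    have hS : 0 < ∑ l ∈ Finset.range j, w l :=
      Finset.sum_pos (fun l _ => (hw.1 l).1) ⟨i, Finset.mem_range.2 hij⟩
    have hdev := (abs_le.1 (hw.2 j (not_lt.1 hj))).1
    have hv := (hw.1 i).1
    set S := ∑ l ∈ Finset.range j, w l
    set μ := theta ν - 1
    have hμj : 0 < μ * j := by positivity
    -- With deviation `err j / 2`, this is `(1 - e/2) (1 + e) ≥ 1` for `0 ≤ e ≤ 1`; halving the
    -- error leaves room to invert the sum.
    have key : μ * j ≤ S * (1 + err j) := by
      nlinarith [mul_nonneg hμj.le (mul_nonneg he0 (sub_nonneg.2 he1)),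
        mul_le_mul_of_nonneg_right hdev (by linarith : 0 ≤ 1 + err j)]
    rw [div_mul_eq_mul_div, div_div, div_le_div_iff₀ hS hμj, mul_assoc, mul_comm (1 + err j)]
    gcongr
  · exact le_rfl

theorem IsWeightLaw.le_attachProb (h : IsWeightLaw ν) {m : ℕ} {w : ℕ → ℝ}
    (hw : w ∈ goodWeights ν m) (i j : ℕ) :
    after i (lowerProb ν m (w i)) j ≤ attachProb (parentLaw w) i j := by
  have hle := (attachProb_mem_Icc (parentLaw w) i j).1
  rw [attachProb_parentLaw fun i => (hw.1 i).1] at hle ⊢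
  unfold after lowerProb at *
  split_ifs at hle ⊢ with hij hj
  · exact hle
  · have hμ := h.mean_mem.1
    have he0 := err_nonneg j
    have he1 := sub_nonneg.2 (err_le_one j)
    have hj0 : (0 : ℝ) < j := by exact_mod_cast (by omega : 0 < j)
    have hS : 0 < ∑ l ∈ Finset.range j, w l :=
      Finset.sum_pos (fun l _ => (hw.1 l).1) ⟨i, Finset.mem_range.2 hij⟩
    have hdev := (abs_le.1 (hw.2 j (not_lt.1 hj))).2
    have hv := (hw.1 i).1
    set S := ∑ l ∈ Finset.range j, w l
    set μ := theta ν - 1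
    have hμj : 0 < μ * j := by positivity
    have key : (1 - err j) * S ≤ μ * j := by
      nlinarith [mul_nonneg hμj.le he0, mul_nonneg hμj.le (mul_nonneg he0 he0),
        mul_le_mul_of_nonneg_right hdev he1]
    rw [div_mul_eq_mul_div, div_div, div_le_div_iff₀ hμj hS, mul_assoc]
    gcongr
  · exact le_rfl

/-! ### First-moment and product bounds for the maximum degree -/

theorem setOf_maxInDegree_lt (n : ℕ) {d : ℕ} (hd : 0 < d) :
    {a : ℕ → ℕ | d ≤ maxInDegree a n}ᶜ = degLT (Finset.range n) n fun _ => d := by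
  ext a
  simp [degLT, maxInDegree, hd]

theorem measurableSet_le_maxInDegree (n d : ℕ) :
    MeasurableSet {a : ℕ → ℕ | d ≤ maxInDegree a n} := by
  rcases Nat.eq_zero_or_pos d with rfl | hd
  · simp
  · rw [← MeasurableSet.compl_iff, setOf_maxInDegree_lt n hd]
    exact measurableSet_degLT _ _ _

theorem parentKernel_apply (w : ℕ → ℝ) : parentKernel w = Measure.infinitePi (parentLaw w) := rfl

theorem IsWeightLaw.parentKernel_le_maxInDegree (h : IsWeightLaw ν) {m : ℕ}
    (hm : 2 / (theta ν - 1) ≤ m) {w : ℕ → ℝ} (hw : w ∈ goodWeights ν m) (n : ℕ) {d : ℕ}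
    (hd : 0 < d) : parentKernel w {a | d ≤ maxInDegree a n} ≤
      ENNReal.ofReal (∑ i ∈ Finset.range n, binTail (after i (upperProb ν m (w i))) n d) := by
  have hsub : {a : ℕ → ℕ | d ≤ maxInDegree a n} ⊆
      ⋃ i ∈ Finset.range n, (degLT {i} n fun _ => d)ᶜ := by
    intro a ha
    rw [← compl_compl {a : ℕ → ℕ | d ≤ maxInDegree a n}, setOf_maxInDegree_lt n hd] at ha
    simpa [degLT] using ha
  rw [← ofReal_measureReal (measure_ne_top _ _)]
  refine ENNReal.ofReal_le_ofReal ((measureReal_mono hsub (measure_ne_top _ _)).trans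
    ((measureReal_biUnion_finset_le _ _).trans (Finset.sum_le_sum fun i _ => ?_)))
  rw [probReal_compl_eq_one_sub (measurableSet_degLT _ _ _), parentKernel_apply,
    measureReal_degLT_singleton, sub_sub_cancel]
  exact binTail_mono (attachProb_mem_Icc _ i)
    (after_mem_Icc (h.upperProb_mem_Icc hm (hw.1 i)) i) n d fun j _ => h.attachProb_le hw i j

theorem IsWeightLaw.parentKernel_maxInDegree_lt (h : IsWeightLaw ν) {m : ℕ}
    (hm : 2 / (theta ν - 1) ≤ m) {w : ℕ → ℝ} (hw : w ∈ goodWeights ν m) (n : ℕ) {d : ℕ}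
    (hd : 0 < d) : parentKernel w {a | d ≤ maxInDegree a n}ᶜ ≤
      ENNReal.ofReal (∏ i : Fin n, (1 - binTail (after i (lowerProb ν m (w i))) n d)) := by
  rw [← ofReal_measureReal (measure_ne_top _ _), setOf_maxInDegree_lt n hd, parentKernel_apply]
  refine ENNReal.ofReal_le_ofReal ((measureReal_degLT_le_prod _ _ _ _).trans ?_)
  rw [← Fin.prod_univ_eq_prod_range fun i => 1 - binTail (attachProb (parentLaw w) i) n d]
  refine Finset.prod_le_prod
    (fun i _ => sub_nonneg.2 (binTail_le_one (attachProb_mem_Icc _ i) _ _)) fun i _ => ?_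
  exact sub_le_sub_left (binTail_mono (after_mem_Icc (h.lowerProb_mem_Icc hm (hw.1 i)) i)
    (attachProb_mem_Icc _ i) n d fun j _ => h.le_attachProb hw i j) 1

theorem law_snd_preimage {E : Set (ℕ → ℕ)} (hE : MeasurableSet E) :
    law ν (Prod.snd ⁻¹' E) = ∫⁻ w, parentKernel w E ∂(Measure.infinitePi fun _ : ℕ => ν) := by
  rw [law, Measure.compProd_apply (measurable_snd hE)]
  rfl

/-- Conditional probabilities are bounded by `f` on good weights and by `1` elsewhere. As `f` is
nonnegative almost surely, it may be integrated over all weights, which preserves their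
independence. -/
theorem law_snd_preimage_le {E : Set (ℕ → ℕ)} (hE : MeasurableSet E) {m : ℕ} {f : (ℕ → ℝ) → ℝ}
    (hf : Integrable f (Measure.infinitePi fun _ : ℕ => ν))
    (hf0 : 0 ≤ᵐ[Measure.infinitePi fun _ : ℕ => ν] f)
    (h : ∀ w ∈ goodWeights ν m, parentKernel w E ≤ ENNReal.ofReal (f w)) :
    law ν (Prod.snd ⁻¹' E) ≤ (Measure.infinitePi fun _ : ℕ => ν) (goodWeights ν m)ᶜ +
      ENNReal.ofReal (∫ w, f w ∂(Measure.infinitePi fun _ : ℕ => ν)) := by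
  have hG := (measurableSet_goodWeights (ν := ν) m).compl
  rw [law_snd_preimage hE, ofReal_integral_eq_lintegral_ofReal hf hf0,
    ← lintegral_indicator_one hG, ← lintegral_add_left (measurable_one.indicator hG)]
  refine lintegral_mono fun w => ?_
  by_cases hw : w ∈ goodWeights ν m
  · exact (h w hw).trans le_add_self
  · rw [Set.indicator_of_mem hw]
    exact prob_le_one.trans le_self_add

/-- In the union bound, the term of vertex `i` depends on the weights through `w i` alone, so
averaging it only involves `ν`. -/
theorem IsWeightLaw.law_le_maxInDegree_le (h : IsWeightLaw ν) {m : ℕ}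
    (hm : 2 / (theta ν - 1) ≤ m) (n : ℕ) {d : ℕ} (hd : 0 < d) :
    law ν (Prod.snd ⁻¹' {a | d ≤ maxInDegree a n}) ≤
      (Measure.infinitePi fun _ : ℕ => ν) (goodWeights ν m)ᶜ +
        ENNReal.ofReal (∫ v, degSum (upperProb ν m v) n d ∂ν) := by
  have hmeas := measurable_binTail_after (measurable_upperProb (ν := ν) m)
  have hbd : ∀ᵐ w ∂(Measure.infinitePi fun _ : ℕ => ν), ∀ i,
      binTail (after i (upperProb ν m (w i))) n d ∈ Set.Icc (0 : ℝ) 1 :=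
    h.ae_weights_mem.mono fun w hw i =>
      have := after_mem_Icc (h.upperProb_mem_Icc hm (hw i)) i
      ⟨binTail_nonneg this n d, binTail_le_one this n d⟩
  have hbd' : ∀ᵐ v ∂ν, ∀ i, binTail (after i (upperProb ν m v)) n d ∈ Set.Icc (0 : ℝ) 1 :=
    h.ae_mem.mono fun v hv i =>
      have := after_mem_Icc (h.upperProb_mem_Icc hm hv) i
      ⟨binTail_nonneg this n d, binTail_le_one this n d⟩
  have hint : ∀ i ∈ Finset.range n, Integrable
      (fun w : ℕ → ℝ => binTail (after i (upperProb ν m (w i))) n d)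
      (Measure.infinitePi fun _ : ℕ => ν) := fun i _ =>
    Integrable.of_mem_Icc 0 1 ((hmeas i n d).comp (measurable_pi_apply i)).aemeasurable
      (hbd.mono fun w hw => hw i)
  refine (law_snd_preimage_le (measurableSet_le_maxInDegree n d) (integrable_finsetSum _ hint)
    (hbd.mono fun w hw => Finset.sum_nonneg fun i _ => (hw i).1)
    fun w hw => h.parentKernel_le_maxInDegree hm hw n hd).trans_eq ?_
  congr 2
  unfold degSum
  rw [integral_finsetSum _ hint, integral_finsetSum _ fun i _ => Integrable.of_mem_Icc 0 1
    (hmeas i n d).aemeasurable (hbd'.mono fun v hv => hv i)]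
  exact Finset.sum_congr rfl fun i _ => integral_comp_eval_infinitePi (hmeas i n d) i

/-- Each factor of the product bound depends on a different weight, so the expectation factorizes,
and `1 - t ≤ exp (-t)` applies to each factor. -/
theorem IsWeightLaw.law_maxInDegree_lt_le (h : IsWeightLaw ν) {m : ℕ}
    (hm : 2 / (theta ν - 1) ≤ m) (n : ℕ) {d : ℕ} (hd : 0 < d) :
    law ν (Prod.snd ⁻¹' {a | d ≤ maxInDegree a n}ᶜ) ≤
      (Measure.infinitePi fun _ : ℕ => ν) (goodWeights ν m)ᶜ +
        ENNReal.ofReal (Real.exp (-∫ v, degSum (lowerProb ν m v) n d ∂ν)) := by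
  set Q := Measure.infinitePi fun _ : ℕ => ν
  have hmeas := measurable_binTail_after (measurable_lowerProb (ν := ν) m)
  have hbd : ∀ᵐ w ∂Q, ∀ i,
      1 - binTail (after i (lowerProb ν m (w i))) n d ∈ Set.Icc (0 : ℝ) 1 :=
    h.ae_weights_mem.mono fun w hw i => by
      have := after_mem_Icc (h.lowerProb_mem_Icc hm (hw i)) i
      have h1 := binTail_nonneg this n d
      have h2 := binTail_le_one this n d
      exact ⟨by linarith, by linarith⟩
  have hbd' : ∀ᵐ v ∂ν, ∀ i, binTail (after i (lowerProb ν m v)) n d ∈ Set.Icc (0 : ℝ) 1 :=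
    h.ae_mem.mono fun v hv i =>
      have := after_mem_Icc (h.lowerProb_mem_Icc hm hv) i
      ⟨binTail_nonneg this n d, binTail_le_one this n d⟩
  have hint' : ∀ i, Integrable (fun v => binTail (after i (lowerProb ν m v)) n d) ν := fun i =>
    Integrable.of_mem_Icc 0 1 (hmeas i n d).aemeasurable (hbd'.mono fun v hv => hv i)
  have hmeas' : ∀ i : ℕ, Measurable
      fun w : ℕ → ℝ => 1 - binTail (after i (lowerProb ν m (w i))) n d := fun i =>
    measurable_const.sub ((hmeas i n d).comp (measurable_pi_apply i))
  refine (law_snd_preimage_le (measurableSet_le_maxInDegree n d).compl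
    (f := fun w => ∏ i : Fin n, (1 - binTail (after i (lowerProb ν m (w i))) n d))
    (Integrable.of_mem_Icc 0 1 (Finset.measurable_fun_prod _ fun (i : Fin n) _ =>
      hmeas' i).aemeasurable (hbd.mono fun w hw =>
        ⟨Finset.prod_nonneg fun i _ => (hw i).1,
          Finset.prod_le_one (fun i _ => (hw i).1) fun i _ => (hw i).2⟩))
    (hbd.mono fun w hw => Finset.prod_nonneg fun i _ => (hw i).1)
    fun w hw => h.parentKernel_maxInDegree_lt hm hw n hd).trans ?_
  gcongr
  have hind : iIndepFun (fun (i : Fin n) (w : ℕ → ℝ) =>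
      1 - binTail (after i (lowerProb ν m (w i))) n d) Q :=
    (iIndepFun_infinitePi (P := fun _ : ℕ => ν)
      (X := fun i v => 1 - binTail (after i (lowerProb ν m v)) n d)
      (fun i => measurable_const.sub (hmeas i n d))).precomp Fin.val_injective
  rw [hind.integral_fun_prod_eq_prod_integral fun i => (hmeas' i).aestronglyMeasurable]
  have hfac : ∀ i : Fin n, ∫ w, (1 - binTail (after i (lowerProb ν m (w i))) n d) ∂Q =
      1 - ∫ v, binTail (after i (lowerProb ν m v)) n d ∂ν := fun i => by
    rw [integral_comp_eval_infinitePi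
      (f := fun v => 1 - binTail (after i (lowerProb ν m v)) n d)
      (measurable_const.sub (hmeas i n d)) i, integral_sub (integrable_const _) (hint' i)]
    simp
  have hle : ∀ i : ℕ, ∫ v, binTail (after i (lowerProb ν m v)) n d ∂ν ≤ 1 := fun i =>
    (integral_mono_ae (hint' i) (integrable_const 1) (hbd'.mono fun v hv => (hv i).2)).trans_eq
      (by simp)
  unfold degSum
  rw [integral_finsetSum _ fun i _ => hint' i, ← Finset.sum_neg_distrib, Real.exp_sum,
    ← Fin.prod_univ_eq_prod_range]
  refine Finset.prod_le_prod (fun i _ => ?_) fun i _ => ?_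
  · rw [hfac]; exact sub_nonneg.2 (hle i)
  · rw [hfac]
    exact Real.one_sub_le_exp_neg _

/-! ### Asymptotics of the integrated degree sums -/

theorem sum_range_inv_le (n : ℕ) : ∑ j ∈ Finset.range n, (j : ℝ)⁻¹ ≤ 1 + Real.log n := by
  rcases n with _ | n
  · simp
  · have h := harmonic_le_one_add_log n
    rw [Finset.sum_range_succ']
    have h1 : Real.log n ≤ Real.log (n + 1 : ℕ) := by
      rcases Nat.eq_zero_or_pos n with rfl | hn
      · simp
      · exact Real.log_le_log (by exact_mod_cast hn) (by push_cast; linarith)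
    simp only [harmonic, Rat.cast_sum, Rat.cast_inv, Rat.cast_natCast] at h
    simp only [CharP.cast_eq_zero, inv_zero, add_zero]
    linarith

theorem IsWeightLaw.integrable_degSum (h : IsWeightLaw ν) {p : ℝ → ℕ → ℝ}
    (hp : ∀ j, Measurable fun v => p v j)
    (hp' : ∀ v ∈ Set.Ioc (0 : ℝ) 1, ∀ j, p v j ∈ Set.Icc (0 : ℝ) 1) (n d : ℕ) :
    Integrable (fun v => degSum (p v) n d) ν :=
  Integrable.of_mem_Icc 0 n (measurable_degSum hp n d).aemeasurable
    (h.ae_mem.mono fun v hv => ⟨degSum_nonneg (hp' v hv) n d, degSum_le (hp' v hv) n d⟩)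

theorem IsWeightLaw.div_mul_one_sub_ratio (h : IsWeightLaw ν) {v : ℝ} (hv : 0 < v) :
    v / (theta ν - 1) * (1 - ratio ν v) = ratio ν v := by
  have hμ := h.mean_mem.1
  unfold ratio
  have : theta ν - 1 + v ≠ 0 := by positivity
  field_simp
  ring

theorem IsWeightLaw.integral_degSum_upperProb_le (h : IsWeightLaw ν) {m : ℕ}
    (hm : 2 / (theta ν - 1) ≤ m) {n d : ℕ} (hn : m ≤ n) (hd : m ≤ d) :
    ∫ v, degSum (upperProb ν m v) n d ∂ν ≤
      Real.exp (∑' j : ℕ, err j / ((j : ℝ) + 1)) / tailProb ν m * (n * tailProb ν d) := by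
  have hμ := h.mean_mem.1
  have hm0 : 0 < m := by
    have : (0 : ℝ) < m := lt_of_lt_of_le (by positivity) hm
    exact_mod_cast this
  obtain ⟨e, rfl⟩ := Nat.exists_eq_add_of_le hd
  set C := Real.exp (∑' j : ℕ, err j / ((j : ℝ) + 1)) with hC
  have hbound : ∀ v ∈ Set.Ioc (0 : ℝ) 1,
      degSum (upperProb ν m v) n (m + e) ≤ C * n * ratio ν v ^ e := fun v hv => by
    refine (degSum_le_of_le hm0 (h.upperProb_mem_Icc hm hv) err_nonneg (h.ratio_mem hv.1).1.le
      (h.div_mul_one_sub_ratio hv.1) (fun j hj => ?_) hn e).trans ?_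
    · rw [upperProb, if_neg (not_lt.2 hj)]
    · have := (h.ratio_mem hv.1).1
      gcongr
      rw [hC, Real.exp_le_exp]
      exact summable_err_div.sum_le_tsum _ fun j _ => div_nonneg (err_nonneg j) (by positivity)
  have h1 : ∫ v, degSum (upperProb ν m v) n (m + e) ∂ν ≤ C * n * tailProb ν e := by
    rw [tailProb_eq, ← integral_const_mul]
    exact integral_mono_ae (h.integrable_degSum (measurable_upperProb m)
      (fun v hv => h.upperProb_mem_Icc hm hv) n _) ((h.integrable_ratio_pow e).const_mul _)
      (h.ae_mem.mono hbound)
  -- The bound has exponent `e = d - m`; association restores the exponent `d`.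
  have h2 := h.tailProb_mul_le m e
  have h3 := h.tailProb_pos m
  have hC0 : 0 < C := Real.exp_pos _
  calc _ ≤ C * n * tailProb ν e := h1
    _ = C / tailProb ν m * (n * (tailProb ν m * tailProb ν e)) := by field_simp
    _ ≤ _ := by gcongr

/-- For weights close to `1`, the vertices before time `m` do not matter. -/
theorem IsWeightLaw.exists_eventually_le_degSum_lowerProb (h : IsWeightLaw ν) {c : ℝ}
    (hc : c ∈ Set.Ioo 0 (theta ν / (theta ν - 1))) {d : ℕ → ℕ}
    (hdc : ∀ᶠ n : ℕ in atTop, (d n : ℝ) < c * Real.log n) {m : ℕ} (hm : 2 / (theta ν - 1) ≤ m)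
    (hm' : ∀ n, ∑ j ∈ Finset.Ico m n, err j / ((j : ℝ) + 1) ≤ 1 / 2) :
    ∃ v₀ < 1, 0 < v₀ ∧ ∀ᶠ n : ℕ in atTop, ∀ v ∈ Set.Icc v₀ 1,
      n / 4 * ratio ν v ^ d n ≤ degSum (lowerProb ν m v) n (d n) := by
  have hμ := h.mean_mem.1
  have hm0 : 0 < m := by
    have : (0 : ℝ) < m := lt_of_lt_of_le (by positivity) hm
    exact_mod_cast this
  set μ := theta ν - 1 with hμdef
  have hθ : theta ν / μ = 1 + 1 / μ := by field_simp; rw [hμdef]; ring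
  rw [hθ] at hc
  have hlim : Tendsto (fun t : ℝ => (1 + (1 - t) / μ) / (1 + t)) (𝓝[>] 0) (𝓝 (1 + 1 / μ)) := by
    have : ContinuousAt (fun t : ℝ => (1 + (1 - t) / μ) / (1 + t)) 0 := by
      refine ContinuousAt.div (by fun_prop) (by fun_prop) (by norm_num)
    simpa using this.tendsto.mono_left nhdsWithin_le_nhds
  -- The gap between `c` and `c'` produces the decaying power `n ^ (-η (c' - c))` that makes the
  -- correction negligible.
  obtain ⟨c', hc1, hc2⟩ := exists_between hc.2
  have hev : ∀ᶠ t in 𝓝[>] (0 : ℝ), t < min 1 μ :=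
    nhdsWithin_le_nhds (Iio_mem_nhds (lt_min one_pos hμ))
  obtain ⟨η, hη1, hη2, hη0⟩ := ((hlim.eventually_const_lt hc2).and
    (hev.and self_mem_nhdsWithin)).exists
  have hη0 : 0 < η := hη0
  have hη3 : η < 1 := hη2.trans_le (min_le_left _ _)
  have hη4 : η < μ := hη2.trans_le (min_le_right _ _)
  refine ⟨1 - η, by linarith, by linarith, ?_⟩
  have hsmall : Tendsto (fun n : ℕ => m * Real.exp (1 - η * (c' - c) * Real.log n)) atTop
      (𝓝 (m * 0)) := by
    refine Tendsto.const_mul _ (Real.tendsto_exp_atBot.comp ?_)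
    have h1 : Tendsto (fun n : ℕ => η * (c' - c) * Real.log n) atTop atTop :=
      (Real.tendsto_log_atTop.comp tendsto_natCast_atTop_atTop).const_mul_atTop
        (mul_pos hη0 (sub_pos.2 hc1))
    simpa [sub_eq_add_neg] using
      tendsto_atBot_add_const_left atTop 1 (tendsto_neg_atTop_atBot.comp h1)
  rw [mul_zero] at hsmall
  filter_upwards [hdc, hsmall.eventually_le_const (by norm_num : (0 : ℝ) < 1 / 4),
    eventually_ge_atTop m] with n hdn hsn hmn v hv
  have hv0 : 0 < v := by linarith [hv.1]
  have hvI : v ∈ Set.Ioc (0 : ℝ) 1 := ⟨hv0, hv.2⟩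
  have hn0 : (0 : ℝ) < n := by exact_mod_cast hm0.trans_le hmn
  have hlog : 0 ≤ Real.log n := Real.log_natCast_nonneg n
  have hx := (h.ratio_mem hv0).1
  have hrx := h.div_mul_one_sub_ratio hv0
  have hx2 : ratio ν v * (1 + v / μ) = v / μ := by linear_combination -hrx
  -- Equivalent to `v η ≤ μ`, which is why `η < μ` was imposed.
  have hy1 : ratio ν v * (1 + η) ≤ 1 := by
    unfold ratio
    rw [div_mul_eq_mul_div, div_le_one (by positivity)]
    nlinarith [hv.2]
  set x := ratio ν v
  set r := v / μ with hr
  have hr0 : 0 < r := by positivity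
  -- The solution of `r (1 - y) = s y` for `y = x (1 + η)`; it equals `1 - η (1 + r) / (1 + η)`, and
  -- `(1 + r) / (1 + η) ≥ c'` for `v ≥ 1 - η`.
  set s := (1 + r) / (1 + η) - r with hs
  have hrs : r * (1 - x * (1 + η)) = s * (x * (1 + η)) := by
    rw [hs]; field_simp; linear_combination -hx2
  have hs0 : 0 ≤ s := by
    have : 0 ≤ s * (x * (1 + η)) := hrs ▸ mul_nonneg hr0.le (sub_nonneg.2 hy1)
    exact nonneg_of_mul_nonneg_left this (by positivity)
  have hs1 : s ≤ 1 - η * c' := by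
    have h1 : c' ≤ (1 + r) / (1 + η) := by
      refine hη1.le.trans ?_
      rw [hr]
      gcongr
      exact hv.1
    have h2 : s = 1 - η * ((1 + r) / (1 + η)) := by rw [hs]; field_simp; ring
    rw [h2]
    gcongr
  refine le_trans ?_ (le_degSum_of_le (ε := err) hm0 (h.lowerProb_mem_Icc hm hvI) err_nonneg
    hr0.le hx.le hrx (le_mul_of_one_le_right hx.le (by linarith)) hy1 hs0 hrs (fun j hj => by
      rw [lowerProb, if_neg (not_lt.2 hj)]) hmn (d n))
  -- The main term is at least `(n / 2) x ^ d`, so a correction of at most `(n / 4) x ^ d` leaves `n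
  -- / 4`.
  have h1 : m * Real.exp (s * ∑ j ∈ Finset.range n, (j : ℝ)⁻¹) * (1 + η) ^ d n ≤ n / 4 := by
    have h2 : s * ∑ j ∈ Finset.range n, (j : ℝ)⁻¹ ≤ 1 + Real.log n - η * c' * Real.log n := by
      have hc0 : 0 < η * c' := mul_pos hη0 (hc.1.trans hc1)
      calc _ ≤ s * (1 + Real.log n) := by
            gcongr
            exact sum_range_inv_le n
        _ ≤ (1 - η * c') * (1 + Real.log n) := by gcongr
        _ ≤ _ := by nlinarith
    have h3 : (1 + η) ^ d n ≤ Real.exp (η * (c * Real.log n)) := by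
      calc (1 + η) ^ d n ≤ Real.exp η ^ d n := by
            gcongr
            linarith [Real.add_one_le_exp η]
        _ = Real.exp (η * d n) := by rw [← Real.exp_nat_mul]; ring_nf
        _ ≤ _ := by gcongr
    calc _ ≤ m * Real.exp (1 + Real.log n - η * c' * Real.log n) *
            Real.exp (η * (c * Real.log n)) := by gcongr
      _ = m * Real.exp (1 - η * (c' - c) * Real.log n) * n := by
          have h6 : Real.exp (1 + Real.log n - η * c' * Real.log n) *
              Real.exp (η * (c * Real.log n)) =
              Real.exp (1 - η * (c' - c) * Real.log n) * Real.exp (Real.log n) := by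
            rw [← Real.exp_add, ← Real.exp_add]; ring_nf
          rw [mul_assoc, h6, Real.exp_log hn0, ← mul_assoc]
      _ ≤ 1 / 4 * n := by gcongr
      _ = n / 4 := by ring
  have h4 := mul_le_mul_of_nonneg_right h1 (pow_nonneg hx.le (d n))
  have h5 := mul_le_mul_of_nonneg_right (hm' n) (mul_nonneg hn0.le (pow_nonneg hx.le (d n)))
  rw [mul_pow]
  nlinarith

theorem IsWeightLaw.tendsto_integral_degSum_lowerProb (h : IsWeightLaw ν) {c : ℝ}
    (hc : c ∈ Set.Ioo 0 (theta ν / (theta ν - 1))) {d : ℕ → ℕ}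
    (hdc : ∀ᶠ n : ℕ in atTop, (d n : ℝ) < c * Real.log n) {m : ℕ} (hm : 2 / (theta ν - 1) ≤ m)
    (hm' : ∀ n, ∑ j ∈ Finset.Ico m n, err j / ((j : ℝ) + 1) ≤ 1 / 2)
    (hlim : Tendsto (fun n : ℕ => (n : ℝ) * tailProb ν (d n)) atTop atTop) :
    Tendsto (fun n => ∫ v, degSum (lowerProb ν m v) n (d n) ∂ν) atTop atTop := by
  obtain ⟨v₀, hv1, hv0, hev⟩ := h.exists_eventually_le_degSum_lowerProb hc hdc hm hm'
  have hpos := h.measure_Ici_pos v₀ hv1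
  refine tendsto_atTop_mono' atTop ?_ (hlim.const_mul_atTop
    (mul_pos hpos (by norm_num : (0 : ℝ) < 1 / 4)))
  filter_upwards [hev] with n hn
  have hint := h.integrable_degSum (measurable_lowerProb m)
    (fun v hv => h.lowerProb_mem_Icc hm hv) n (d n)
  calc ν.real (Set.Ici v₀) * (1 / 4) * (n * tailProb ν (d n))
      = n / 4 * (tailProb ν (d n) * ν.real (Set.Ici v₀)) := by ring
    _ ≤ n / 4 * ∫ v in Set.Ici v₀, ratio ν v ^ d n ∂ν := by
        gcongr
        exact h.tailProb_mul_measureReal_le _ _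
    _ = ∫ v in Set.Ici v₀, n / 4 * ratio ν v ^ d n ∂ν := (integral_const_mul _ _).symm
    _ ≤ ∫ v in Set.Ici v₀, degSum (lowerProb ν m v) n (d n) ∂ν := by
        refine integral_mono_ae ((h.integrable_ratio_pow _).const_mul _).integrableOn
          hint.integrableOn ?_
        filter_upwards [ae_restrict_mem measurableSet_Ici, ae_restrict_of_ae h.ae_mem] with v hv hv'
        exact hn v ⟨hv, hv'.2⟩
    _ ≤ _ := setIntegral_le_integral hint
        (h.ae_mem.mono fun v hv => degSum_nonneg (h.lowerProb_mem_Icc hm hv) _ _)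

theorem eventually_sum_Ico_err_le :
    ∀ᶠ m : ℕ in atTop, ∀ n, ∑ j ∈ Finset.Ico m n, err j / ((j : ℝ) + 1) ≤ 1 / 2 := by
  have hs := summable_err_div
  have h0 := hs.hasSum.tendsto_sum_nat
  filter_upwards [h0.eventually_const_le (sub_lt_self _ (by norm_num : (0 : ℝ) < 1 / 2))]
    with m hm n
  rcases le_total m n with hmn | hmn
  · rw [Finset.sum_Ico_eq_sub _ hmn]
    have := hs.sum_le_tsum (Finset.range n) fun j _ => div_nonneg (err_nonneg j) (by positivity)
    linarith
  · simp [Finset.Ico_eq_empty_of_le hmn]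

/-! ### The double limit and the conclusion -/

theorem tendsto_zero_of_eventually_le_add {u g : ℕ → ENNReal} {f : ℕ → ℕ → ℝ}
    (hg : Tendsto g atTop (𝓝 0)) (hf : ∀ᶠ m in atTop, Tendsto (f m) atTop (𝓝 0))
    (hu : ∀ᶠ m in atTop, ∀ᶠ n in atTop, u n ≤ g m + ENNReal.ofReal (f m n)) :
    Tendsto u atTop (𝓝 0) := by
  rw [ENNReal.tendsto_nhds_zero] at hg ⊢
  intro ε hε
  have hε2 : 0 < ε / 2 := ENNReal.half_pos hε.ne'
  obtain ⟨m, hm1, hm2, hm3⟩ := ((hg _ hε2).and (hf.and hu)).exists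
  have h0 : Tendsto (fun n => ENNReal.ofReal (f m n)) atTop (𝓝 0) := by
    simpa using ENNReal.tendsto_ofReal hm2
  filter_upwards [hm3, ENNReal.tendsto_nhds_zero.1 h0 _ hε2] with n h1 h2
  exact h1.trans ((add_le_add hm1 h2).trans_eq (ENNReal.add_halves ε))

theorem IsWeightLaw.tendsto_law_le_maxInDegree_zero (h : IsWeightLaw ν) {d : ℕ → ℕ}
    (hd : Tendsto d atTop atTop)
    (hlim : Tendsto (fun n : ℕ => (n : ℝ) * tailProb ν (d n)) atTop (𝓝 0)) :
    Tendsto (fun n => law ν (Prod.snd ⁻¹' {a | d n ≤ maxInDegree a n})) atTop (𝓝 0) := by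
  refine tendsto_zero_of_eventually_le_add h.tendsto_measure_compl_goodWeights
    (f := fun m n => Real.exp (∑' j : ℕ, err j / ((j : ℝ) + 1)) / tailProb ν m *
      (n * tailProb ν (d n))) (Eventually.of_forall fun m => by simpa using hlim.const_mul _) ?_
  filter_upwards [tendsto_natCast_atTop_atTop.eventually_ge_atTop (2 / (theta ν - 1))] with m hm
  filter_upwards [eventually_ge_atTop m, hd.eventually_ge_atTop m, hd.eventually_gt_atTop 0]
    with n hn hdm hd0
  exact (h.law_le_maxInDegree_le hm n hd0).trans (add_le_add le_rfl
    (ENNReal.ofReal_le_ofReal (h.integral_degSum_upperProb_le hm hn hdm)))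

theorem IsWeightLaw.tendsto_law_maxInDegree_lt_zero (h : IsWeightLaw ν) {c : ℝ}
    (hc : c ∈ Set.Ioo 0 (theta ν / (theta ν - 1))) {d : ℕ → ℕ} (hd : Tendsto d atTop atTop)
    (hdc : ∀ᶠ n : ℕ in atTop, (d n : ℝ) < c * Real.log n)
    (hlim : Tendsto (fun n : ℕ => (n : ℝ) * tailProb ν (d n)) atTop atTop) :
    Tendsto (fun n => law ν (Prod.snd ⁻¹' {a | d n ≤ maxInDegree a n}ᶜ)) atTop (𝓝 0) := by
  have hm := tendsto_natCast_atTop_atTop.eventually_ge_atTop (2 / (theta ν - 1))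
  refine tendsto_zero_of_eventually_le_add h.tendsto_measure_compl_goodWeights
    (f := fun m n => Real.exp (-∫ v, degSum (lowerProb ν m v) n (d n) ∂ν)) ?_ ?_
  · filter_upwards [hm, eventually_sum_Ico_err_le] with m hm hm'
    exact Real.tendsto_exp_neg_atTop_nhds_zero.comp
      (h.tendsto_integral_degSum_lowerProb hc hdc hm hm' hlim)
  · filter_upwards [hm] with m hm
    filter_upwards [hd.eventually_gt_atTop 0] with n hd0
    exact h.law_maxInDegree_lt_le hm n hd0

end WRT

theorem mainTheorem7 {Ω : Type*} [MeasurableSpace Ω] (P : Measure Ω)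
    (ν : Measure ℝ) [IsProbabilityMeasure ν]
    (hpos : ∀ᵐ x ∂ν, 0 < x)
    (hsup : sSup {x : ℝ | 0 < x ∧ ν (Set.Iic x) < 1} = 1)
    (W : ℕ → Ω → ℝ) (A : ℕ → Ω → ℕ) (hWA : WRT.IsWRT P ν W A)
    (c : ℝ) (hc : c ∈ Set.Ioo 0 (WRT.theta ν / (WRT.theta ν - 1)))
    (d : ℕ → ℕ) (hd : Tendsto d atTop atTop)
    (hdc : ∀ᶠ n : ℕ in atTop, (d n : ℝ) < c * Real.log n) :
    (Tendsto (fun n : ℕ => (n : ℝ) * WRT.tailProb ν (d n)) atTop (𝓝 0) →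
      Tendsto (fun n : ℕ => P {ω | d n ≤ WRT.maxInDegree (fun j => A j ω) n}) atTop (𝓝 0)) ∧
    (Tendsto (fun n : ℕ => (n : ℝ) * WRT.tailProb ν (d n)) atTop atTop →
      Tendsto (fun n : ℕ => P {ω | d n ≤ WRT.maxInDegree (fun j => A j ω) n}) atTop (𝓝 1)) := by
  have h := WRT.isWeightLaw_of_sSup_eq_one hpos hsup
  -- The events depend only on the joint law, so they can be computed under `law ν`.
  have hP : ∀ n, P {ω | d n ≤ WRT.maxInDegree (fun j => A j ω) n} =
      WRT.law ν (Prod.snd ⁻¹' {a | d n ≤ WRT.maxInDegree a n}) := fun n =>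
    HasLaw.measure_eq hWA (p := fun q => d n ≤ WRT.maxInDegree q.2 n)
      (measurable_snd (WRT.measurableSet_le_maxInDegree n (d n)))
  simp only [hP]
  refine ⟨h.tendsto_law_le_maxInDegree_zero hd, fun hlim => ?_⟩
  have h0 := h.tendsto_law_maxInDegree_lt_zero hc hd hdc hlim
  have h1 : ∀ n, WRT.law ν (Prod.snd ⁻¹' {a | d n ≤ WRT.maxInDegree a n}) =
      1 - WRT.law ν (Prod.snd ⁻¹' {a | d n ≤ WRT.maxInDegree a n}ᶜ) := fun n => by
    have := prob_compl_eq_one_sub (μ := WRT.law ν)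
      (measurable_snd (α := ℕ → ℝ) (WRT.measurableSet_le_maxInDegree n (d n)).compl)
    rwa [Set.preimage_compl, compl_compl] at this
  simp only [h1]
  simpa using ENNReal.Tendsto.sub tendsto_const_nhds h0 (Or.inl ENNReal.one_ne_top)
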